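/- Let $H$ be a real Hilbert space, $\beta>0$, $\rho\in(0,2\beta)$. Let $f:H\to\mathbb R$ be convex and differentiable with $\frac1\beta$-Lipschitz gradient, let $g:H\to(-\infty,+\infty]$ be proper, convex and lower semicontinuous, and suppose $\Omega:=\operatorname{Argmin}(f+g)\neq\varnothing$. Put $\operatorname{prox}_{\rho g}(u)=\arg\min_x\{\frac1{2\rho}\|x-u\|^2+g(x)\}$ and $T:=\operatorname{prox}_{\rho g}\circ(I-\rho\nabla f)$. For arbitrary $z^{-1},z^0\in H$ let $$\mu^k=z^k+\alpha_k(z^k-z^{k-1}),\qquad z^{k+1}=\mu^k+\lambda_k\big(\operatorname{prox}_{\rho g}(\mu^k-\rho(\nabla f(\mu^k)+e^{1,k}))+e^{2,k}-\mu^k\big)\qquad(k\ge 0).$$ Assume that $\{z^k\}_{k\ge0}$ is bounded, that $0\le\alpha_k\le\alpha<1$ for all $k$, and that one of the following holds for some $\lambda>0$. (I) $\lambda\le\lambda_k\le\lambda'<\frac{4\beta-\rho}{2\beta}$ for all $k$, and $\sum_{k\ge0}\alpha_k\|z^k-z^{k-1}\|^2<\infty$, $\sum_{k\ge0}\lambda_k\|e^{1,k}\|<\infty$,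 $\sum_{k\ge0}\lambda_k\|e^{2,k}\|<\infty$. In this case put $\theta:=\lambda'$. (II) $\alpha_0=0$, $\{\alpha_k\}$ is nondecreasing, $\sum_{k\ge0}\|e^{1,k}\|<\infty$, $\sum_{k\ge0}\|e^{2,k}\|<\infty$, and there are $\sigma,\delta>0$ with $$\delta>\frac{\alpha[\alpha(1+\alpha)+\sigma]}{1-\alpha^2},\qquad \lambda\le\lambda_k\le\overline\lambda:=\frac{4\beta-\rho}{2\beta}\cdot\frac{\delta-\alpha[\alpha(1+\alpha)+\alpha\delta+\sigma]}{\delta[1+\alpha(1+\alpha)+\alpha\delta+\sigma]}\quad\text{for all }k.$$ In this case put $\theta:=\overline\lambda$. Then: (i) $\lim_{k\to\infty}\|z^k-z^*\|$ exists for every $z^*\in\Omega$; (ii) $\{z^k\}$ converges weakly to a point of $\Omega$; (iii) $\theta<\frac{4\beta-\rho}{2\beta}$, and for every $z^*\in\Omega$ and every $k\ge1$ $$\min_{1\le i\le k}\|T\mu^i-\mu^i\|^2\le\frac{1}{k\,\lambda\left(\frac{4\beta-\rho}{2\beta}-\theta\right)}\left(\|z^1-z^*\|^2+\Delta\right),$$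 where, with $e^k:=\operatorname{prox}_{\rho g}(\mu^k-\rho(\nabla f(\mu^k)+e^{1,k}))+e^{2,k}-T\mu^k$ and $[t]_+=\max\{t,0\}$, $$\Delta=\alpha\sum_{k\ge1}\big[\|z^k-z^*\|^2-\|z^{k-1}-z^*\|^2\big]_+ +\sum_{k\ge1}2\|z^{k+1}-z^*\|\lambda_k\|e^k\|+\sum_{k\ge1}\alpha_k(1+\alpha_k)\|z^k-z^{k-1}\|^2,$$ and each of these three series converges, so $\Delta<\infty$. -/

import Mathlib

open Filter Topology Gradient

noncomputable section

namespace InertialFB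

variable {H : Type*} [NormedAddCommGroup H] [InnerProductSpace ℝ H]

/-- Properness of `g : H → (-∞, +∞]`: never `-∞`, and finite somewhere. -/
def IsProper (g : H → EReal) : Prop :=
  (∀ x, g x ≠ ⊥) ∧ ∃ x, g x ≠ ⊤

/-- Convexity of an extended-real-valued function. -/
def IsConvex (g : H → EReal) : Prop :=
  ∀ x y : H, ∀ a b : ℝ, 0 < a → 0 < b → a + b = 1 →
    g (a • x + b • y) ≤ (a : EReal) * g x + (b : EReal) * g y

/-- The set of global minimizers of an extended-real-valued function. -/
def argmin (F : H → EReal) : Set H :=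
  {x | ∀ y, F x ≤ F y}

/-- The objective function `f + g`. -/
def objective (f : H → ℝ) (g : H → EReal) (x : H) : EReal :=
  (f x : EReal) + g x

/-- The proximity operator `prox_{γ g}(u) = argmin_x { (1 / (2γ)) ‖x - u‖² + g x }`.
For `γ > 0` and `g` proper, convex and lower semicontinuous the minimizer exists and is unique. -/
def prox (γ : ℝ) (g : H → EReal) (u : H) : H :=
  Classical.epsilon fun p =>
    p ∈ argmin fun x => ((1 / (2 * γ) * ‖x - u‖ ^ 2 : ℝ) : EReal) + g x

variable [CompleteSpace H]

/-- The forward-backward operator `T = prox_{ρ g} ∘ (I - ρ ∇f)`. -/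
def fbOp (ρ : ℝ) (f : H → ℝ) (g : H → EReal) (u : H) : H :=
  prox ρ g (u - ρ • ∇ f u)

/-- The inexact inertial proximal-gradient scheme. The iterates `z` are indexed by integers so that
`z (-1)` and `z 0` are the (arbitrary) starting points; the other sequences start at `0`. -/
structure IsScheme (ρ : ℝ) (f : H → ℝ) (g : H → EReal) (α lam : ℕ → ℝ) (e₁ e₂ : ℕ → H)
    (z : ℤ → H) (μ : ℕ → H) : Prop where
  inertial : ∀ k : ℕ, μ k = z k + α k • (z k - z (k - 1))
  step : ∀ k : ℕ, z (k + 1) =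
    μ k + lam k • (prox ρ g (μ k - ρ • (∇ f (μ k) + e₁ k)) + e₂ k - μ k)

/-- The first set of conditions on the parameters and errors, with `a` the upper bound of the
inertial parameters and `lamLow`, `lamUp` the bounds of the relaxation parameters. -/
structure ConditionI (β ρ : ℝ) (α lam : ℕ → ℝ) (e₁ e₂ : ℕ → H) (z : ℤ → H)
    (a lamLow lamUp : ℝ) : Prop where
  inertia_bounds : ∀ k, 0 ≤ α k ∧ α k ≤ a
  a_lt_one : a < 1
  lamLow_pos : 0 < lamLow
  relax_bounds : ∀ k, lamLow ≤ lam k ∧ lam k ≤ lamUp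
  lamUp_lt : lamUp < (4 * β - ρ) / (2 * β)
  summable_inertia : Summable fun k : ℕ => α k * ‖z k - z (k - 1)‖ ^ 2
  summable_e₁ : Summable fun k => lam k * ‖e₁ k‖
  summable_e₂ : Summable fun k => lam k * ‖e₂ k‖
  bounded : Bornology.IsBounded (Set.range fun k : ℕ => z k)

/-- The upper bound of the relaxation parameters in the second set of conditions. -/
def lamBar (β ρ a σ δ : ℝ) : ℝ :=
  (4 * β - ρ) / (2 * β) *
    ((δ - a * (a * (1 + a) + a * δ + σ)) / (δ * (1 + a * (1 + a) + a * δ + σ)))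

/-- The second set of conditions on the parameters and errors. -/
structure ConditionII (β ρ : ℝ) (α lam : ℕ → ℝ) (e₁ e₂ : ℕ → H) (z : ℤ → H)
    (a lamLow σ δ : ℝ) : Prop where
  inertia_bounds : ∀ k, 0 ≤ α k ∧ α k ≤ a
  a_lt_one : a < 1
  inertia_zero : α 0 = 0
  inertia_mono : Monotone α
  σ_pos : 0 < σ
  δ_pos : 0 < δ
  δ_gt : a * (a * (1 + a) + σ) / (1 - a ^ 2) < δ
  lamLow_pos : 0 < lamLow
  relax_bounds : ∀ k, lamLow ≤ lam k ∧ lam k ≤ lamBar β ρ a σ δ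
  summable_e₁ : Summable fun k => ‖e₁ k‖
  summable_e₂ : Summable fun k => ‖e₂ k‖
  bounded : Bornology.IsBounded (Set.range fun k : ℕ => z k)

/-- The total error `e k` committed in step `k` in evaluating `T (μ k)`, so that
`z (k + 1) = μ k + lam k • (T (μ k) + e k - μ k)`. -/
def totalError (ρ : ℝ) (f : H → ℝ) (g : H → EReal) (e₁ e₂ : ℕ → H) (μ : ℕ → H) (k : ℕ) : H :=
  prox ρ g (μ k - ρ • (∇ f (μ k) + e₁ k)) + e₂ k - fbOp ρ f g (μ k)

/-- `k`-th term of the first series in `Δ`: `[‖z k - z*‖² - ‖z (k-1) - z*‖²]₊`. -/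
def incrTerm (z : ℤ → H) (zs : H) (k : ℕ) : ℝ :=
  max (‖z k - zs‖ ^ 2 - ‖z (k - 1) - zs‖ ^ 2) 0

/-- `k`-th term of the second series in `Δ`: `2 ‖z (k+1) - z*‖ * lam k * ‖e k‖`. -/
def errTerm (lam : ℕ → ℝ) (e : ℕ → H) (z : ℤ → H) (zs : H) (k : ℕ) : ℝ :=
  2 * ‖z (k + 1) - zs‖ * lam k * ‖e k‖

/-- `k`-th term of the third series in `Δ`: `α k * (1 + α k) * ‖z k - z (k-1)‖²`. -/
def inertiaTerm (α : ℕ → ℝ) (z : ℤ → H) (k : ℕ) : ℝ :=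
  α k * (1 + α k) * ‖z k - z (k - 1)‖ ^ 2

/-- The constant `Δ`; each of the three series runs over `k ≥ 1`. -/
def Delta (a : ℝ) (α lam : ℕ → ℝ) (e : ℕ → H) (z : ℤ → H) (zs : H) : ℝ :=
  a * (∑' k : ℕ, incrTerm z zs (k + 1)) + (∑' k : ℕ, errTerm lam e z zs (k + 1))
    + ∑' k : ℕ, inertiaTerm α z (k + 1)

end InertialFB

end

/-! Write κ = (4β - ρ)/(2β). Everything rests on the inequality κ‖Tx - x‖² ≤ 2⟪x - Tx, x - s⟫ for
every minimizer s (`fbOp_quasi_averaged`), which combines firm nonexpansiveness of the resolvent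
with cocoercivity of ∇f (`gradient_cocoercive`). Inserted into one relaxed inertial step, it bounds
φ_k = ‖z^k - s‖² by φ_{k+1} ≤ (1 + α_k)φ_k - α_kφ_{k-1} + inertia + error - λ_k(κ - λ_k)‖Tμ^k -
μ^k‖² (`IsScheme.sq_dist_le`).

If inertia and error are summable, the positive parts of the increments of φ obey p_{k+1} ≤ a p_k +
summable with a < 1. So they are summable, φ converges, and telescoping bounds the sum of squared
residuals by the constant in (iii). Condition (II) reduces to condition (I) with upper bound
`lamBar`: a Lyapunov function makes ‖z^k - z^{k-1}‖² summable (`ConditionII.toConditionI`).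

For weak convergence, residuals and μ^k - z^k tend to 0, so by demiclosedness weak cluster points
are fixed points of T, hence minimizers, and Opial's lemma applies. -/

namespace InertialFB

open scoped InnerProductSpace

/-! ### Convex functions with Lipschitz gradient -/

section Smooth

variable {H : Type*} [NormedAddCommGroup H] [InnerProductSpace ℝ H] [CompleteSpace H]

lemma hasDerivAt_comp_segment {h : H → ℝ} {v p d : H} {t : ℝ} (hh : HasGradientAt h v (p + t • d)) :
    HasDerivAt (fun s : ℝ => h (p + s • d)) ⟪v, d⟫_ℝ t := by
  have h1 : HasDerivAt (fun s : ℝ => p + s • d) d t := by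
    simpa using ((hasDerivAt_id t).smul_const d).const_add p
  exact (hh.hasFDerivAt.comp_hasDerivAt t h1).congr_deriv (by simp)

/-- A differentiable convex function lies above its tangents. -/
lemma tangent_le_of_convexOn {f : H → ℝ} (hf : ConvexOn ℝ Set.univ f) {v x : H}
    (hv : HasGradientAt f v x) (y : H) : f x + ⟪v, y - x⟫_ℝ ≤ f y := by
  have hd : HasDerivAt (fun s : ℝ => f (x + s • (y - x))) ⟪v, y - x⟫_ℝ 0 :=
    hasDerivAt_comp_segment (by simpa using hv)
  have h := hd.tendsto_slope_zero_right
  have hle : ∀ᶠ t : ℝ in 𝓝[>] 0,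
      t⁻¹ • (f (x + (0 + t) • (y - x)) - f (x + (0 : ℝ) • (y - x))) ≤ f y - f x := by
    filter_upwards [Ioo_mem_nhdsGT (zero_lt_one' ℝ)] with t ht
    have hc := hf.2 (Set.mem_univ x) (Set.mem_univ y) (sub_nonneg.2 ht.2.le) ht.1.le (by ring)
    have e : (1 - t) • x + t • y = x + t • (y - x) := by module
    rw [e] at hc
    simp only [smul_eq_mul, zero_add, zero_smul, add_zero] at hc ⊢
    rw [inv_mul_le_iff₀ ht.1]
    linarith
  linarith [le_of_tendsto h hle]

/-- The descent lemma for functions with Lipschitz gradient. -/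
lemma le_tangent_add_sq {f : H → ℝ} (hf : Differentiable ℝ f) {L : ℝ}
    (hL : ∀ x y, ‖∇ f x - ∇ f y‖ ≤ L * ‖x - y‖) (x y : H) :
    f y ≤ f x + ⟪∇ f x, y - x⟫_ℝ + L / 2 * ‖y - x‖ ^ 2 := by
  set d := y - x with hd
  -- Subtracting the tangent and the quadratic leaves a function on the segment whose derivative is
  -- nonpositive by the Lipschitz bound; comparing its endpoints gives the claim.
  have hder : ∀ t : ℝ, HasDerivAt
      (fun s : ℝ => f (x + s • d) - s * ⟪∇ f x, d⟫_ℝ - L / 2 * ‖d‖ ^ 2 * s ^ 2)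
      (⟪∇ f (x + t • d), d⟫_ℝ - ⟪∇ f x, d⟫_ℝ - L * ‖d‖ ^ 2 * t) t := by
    intro t
    have h1 := hasDerivAt_comp_segment (t := t) (d := d) (p := x) (hf (x + t • d)).hasGradientAt
    have h2 := (hasDerivAt_id t).mul_const ⟪∇ f x, d⟫_ℝ
    have h3 := ((hasDerivAt_id t).pow 2).const_mul (L / 2 * ‖d‖ ^ 2)
    refine ((h1.sub h2).sub h3).congr_deriv ?_
    simp only [id, one_mul, Nat.cast_ofNat, mul_one]
    ring
  have hanti : AntitoneOn
      (fun s : ℝ => f (x + s • d) - s * ⟪∇ f x, d⟫_ℝ - L / 2 * ‖d‖ ^ 2 * s ^ 2) (Set.Icc 0 1) := by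
    refine antitoneOn_of_deriv_nonpos (convex_Icc 0 1)
      (fun t _ => (hder t).continuousAt.continuousWithinAt)
      (fun t _ => (hder t).differentiableAt.differentiableWithinAt) fun t ht => ?_
    rw [interior_Icc] at ht
    rw [(hder t).deriv, ← inner_sub_left]
    have h1 := real_inner_le_norm (∇ f (x + t • d) - ∇ f x) d
    have h2 := hL (x + t • d) x
    rw [add_sub_cancel_left, norm_smul, Real.norm_of_nonneg ht.1.le] at h2
    nlinarith [norm_nonneg d]
  have h := hanti (Set.left_mem_Icc.2 zero_le_one) (Set.right_mem_Icc.2 zero_le_one) zero_le_one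
  have e : x + d = y := by simp [hd]
  simp only [one_smul, zero_smul, e, add_zero] at h
  linarith

/-- Baillon–Haddad: the gradient of a convex function is cocoercive if it is Lipschitz. -/
lemma gradient_cocoercive {f : H → ℝ} (hconv : ConvexOn ℝ Set.univ f) (hf : Differentiable ℝ f)
    {β : ℝ} (hβ : 0 < β) (hL : ∀ x y, ‖∇ f x - ∇ f y‖ ≤ 1 / β * ‖x - y‖) (x y : H) :
    β * ‖∇ f x - ∇ f y‖ ^ 2 ≤ ⟪∇ f x - ∇ f y, x - y⟫_ℝ := by
  have key : ∀ x y : H,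
      f x + ⟪∇ f x, y - x⟫_ℝ + β / 2 * ‖∇ f x - ∇ f y‖ ^ 2 ≤ f y := by
    intro x y
    set w := ∇ f x - ∇ f y with hw
    -- The point y + βw is the gradient step of length β = 1/L from y for f - ⟪∇f x, ·⟫. The tangent
    -- at x bounds f there from below, the descent lemma at y from above.
    have h1 := tangent_le_of_convexOn hconv (hf x).hasGradientAt (y + β • w)
    have h2 := le_tangent_add_sq hf hL y (y + β • w)
    have e1 : y + β • w - x = (y - x) + β • w := by abel
    rw [e1, inner_add_right, inner_smul_right] at h1
    rw [add_sub_cancel_left, inner_smul_right, norm_smul, Real.norm_of_nonneg hβ.le] at h2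
    have e2 : ⟪∇ f x, w⟫_ℝ - ⟪∇ f y, w⟫_ℝ = ‖w‖ ^ 2 := by
      rw [← inner_sub_left, ← hw, real_inner_self_eq_norm_sq]
    have e3 : 1 / β / 2 * (β * ‖w‖) ^ 2 = β / 2 * ‖w‖ ^ 2 := by field_simp
    have e4 : β * ⟪∇ f x, w⟫_ℝ - β * ⟪∇ f y, w⟫_ℝ = β * ‖w‖ ^ 2 := by rw [← e2]; ring
    linarith
  have h1 := key x y
  have h2 := key y x
  rw [norm_sub_rev (∇ f y)] at h2
  have e : ⟪∇ f x - ∇ f y, x - y⟫_ℝ = -⟪∇ f x, y - x⟫_ℝ - ⟪∇ f y, x - y⟫_ℝ := by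
    rw [inner_sub_left, ← neg_sub y x, inner_neg_right (∇ f x)]
  linarith

end Smooth

/-! ### Subgradients and the proximity operator -/

section Prox

variable {H : Type*} [NormedAddCommGroup H] [InnerProductSpace ℝ H]

/-- `v` is a subgradient of `g` at the point `p` of its domain. -/
def IsSubgradient (g : H → EReal) (p v : H) : Prop :=
  ∃ c : ℝ, g p = c ∧ ∀ (y : H) (d : ℝ), g y = d → c + ⟪v, y - p⟫_ℝ ≤ d

lemma IsSubgradient.monotone {g : H → EReal} {p q v w : H} (hp : IsSubgradient g p v)
    (hq : IsSubgradient g q w) : 0 ≤ ⟪p - q, v - w⟫_ℝ := by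
  obtain ⟨c, hc, h1⟩ := hp
  obtain ⟨d, hd, h2⟩ := hq
  have h1 := h1 q d hd
  have h2 := h2 p c hc
  have e : ⟪p - q, v - w⟫_ℝ = -⟪v, q - p⟫_ℝ - ⟪w, p - q⟫_ℝ := by
    rw [real_inner_comm, inner_sub_left, ← neg_sub q p, inner_neg_right v]
  linarith

/-- A subgradient `-v` of `g` at `p`, together with an affine minorant of slope `v` of `h` that is
exact at `p`, makes `p` a minimizer of `h + g`. -/
lemma IsSubgradient.mem_argmin {g : H → EReal} (hg : ∀ x, g x ≠ ⊥) {h : H → ℝ} {p v : H}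
    (hp : IsSubgradient g p (-v)) (hh : ∀ y, h p + ⟪v, y - p⟫_ℝ ≤ h y) :
    p ∈ argmin (objective h g) := by
  obtain ⟨c, hc, hsub⟩ := hp
  intro y
  simp only [objective, hc]
  rcases eq_or_ne (g y) ⊤ with hy | hy
  · simp [hy]
  · lift g y to ℝ using ⟨hy, hg y⟩ with d hd
    have h1 := hsub y d hd.symm
    rw [inner_neg_left] at h1
    exact_mod_cast (by linarith [hh y] : h p + c ≤ h y + d)

/-- Moves convexity from `EReal` to ℝ: a finite upper bound and g ≠ -∞ force finite values between
points of the domain, so later estimates are plain real arithmetic. -/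
lemma convex_real {g : H → EReal} (hg : ∀ x, g x ≠ ⊥) (hconv : IsConvex g) {x y : H} {c d a b : ℝ}
    (hc : g x ≤ c) (hd : g y ≤ d) (ha : 0 < a) (hb : 0 < b) (hab : a + b = 1) :
    ∃ r : ℝ, g (a • x + b • y) = r ∧ r ≤ a * c + b * d := by
  have h := hconv x y a b ha hb hab
  have h2 : g (a • x + b • y) ≤ ((a * c + b * d : ℝ) : EReal) := by
    refine h.trans ?_
    push_cast
    exact add_le_add (mul_le_mul_of_nonneg_left hc (by exact_mod_cast ha.le))
      (mul_le_mul_of_nonneg_left hd (by exact_mod_cast hb.le))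
  have htop : g (a • x + b • y) ≠ ⊤ := fun h3 => by
    rw [h3] at h2; exact absurd (top_le_iff.1 h2) (EReal.coe_ne_top _)
  refine ⟨(g (a • x + b • y)).toReal, (EReal.coe_toReal htop (hg _)).symm, ?_⟩
  rwa [← EReal.coe_toReal htop (hg _), EReal.coe_le_coe_iff] at h2

lemma exists_eq_coe_of_mem_argmin {H : Type*} {g : H → EReal} (hg : IsProper g) {h : H → ℝ} {p : H}
    (hp : p ∈ argmin (objective h g)) : ∃ c : ℝ, g p = c := by
  obtain ⟨x, hx⟩ := hg.2
  have htop : g p ≠ ⊤ := by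
    intro h1
    have h2 := hp x
    lift g x to ℝ using ⟨hx, hg.1 x⟩ with d hd
    simp only [objective, h1, ← hd, EReal.coe_add_top, top_le_iff] at h2
    exact absurd h2 (by exact_mod_cast EReal.coe_ne_top (h x + d))
  exact ⟨_, (EReal.coe_toReal htop (hg.1 _)).symm⟩

/-- Fermat's rule for the sum of a differentiable and a convex function. -/
lemma isSubgradient_of_mem_argmin [CompleteSpace H] {g : H → EReal} (hg : IsProper g)
    (hconv : IsConvex g) {h : H → ℝ} {p v : H} (hh : HasGradientAt h v p)
    (hp : p ∈ argmin (objective h g)) : IsSubgradient g p (-v) := by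
  obtain ⟨c, hc⟩ := exists_eq_coe_of_mem_argmin hg hp
  refine ⟨c, hc, fun y d hd => ?_⟩
  have hder : HasDerivAt (fun s : ℝ => h (p + s • (y - p))) ⟪v, y - p⟫_ℝ 0 :=
    hasDerivAt_comp_segment (by simpa using hh)
  have hlim := hder.tendsto_slope_zero_right
  have hle : ∀ᶠ t : ℝ in 𝓝[>] 0,
      c - d ≤ t⁻¹ • (h (p + (0 + t) • (y - p)) - h (p + (0 : ℝ) • (y - p))) := by
    filter_upwards [Ioo_mem_nhdsGT (zero_lt_one' ℝ)] with t ht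
    obtain ⟨r, hr, hrle⟩ := convex_real hg.1 hconv hc.le hd.le (sub_pos.2 ht.2) ht.1 (by ring)
    have h1 := hp ((1 - t) • p + t • y)
    simp only [objective, hr, hc] at h1
    have h1 : h p + c ≤ h ((1 - t) • p + t • y) + r := by exact_mod_cast h1
    have e : (1 - t) • p + t • y = p + t • (y - p) := by module
    rw [e] at h1
    simp only [smul_eq_mul, zero_add, zero_smul, add_zero]
    rw [le_inv_mul_iff₀ ht.1]
    linarith
  have := ge_of_tendsto hlim hle
  rw [inner_neg_left]
  linarith

/-- Existence of proximal points for a function that has an affine minorant. -/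
lemma exists_mem_argmin_prox [CompleteSpace H] {g : H → EReal} (hg : IsProper g)
    (hconv : IsConvex g) (hlsc : LowerSemicontinuous g) {q v : H} (hq : IsSubgradient g q v)
    {γ : ℝ} (hγ : 0 < γ) (u : H) :
    ∃ p, p ∈ argmin (objective (fun x => 1 / (2 * γ) * ‖x - u‖ ^ 2) g) := by
  obtain ⟨c, hc, hsub⟩ := hq
  set s : ℝ := 1 / (2 * γ) with hs
  have hs0 : 0 < s := by positivity
  set V : Set ℝ := {r | ∃ (x : H) (d : ℝ), g x = d ∧ r = s * ‖x - u‖ ^ 2 + d} with hV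
  have hVne : V.Nonempty := ⟨_, q, c, hc, rfl⟩
  have hVbdd : BddBelow V := by
    -- The affine minorant of g is at worst linear in ‖x - u‖; completing the square against s‖x -
    -- u‖² gives this bound.
    refine ⟨c + ⟪v, u - q⟫_ℝ - ‖v‖ ^ 2 / (4 * s), ?_⟩
    rintro r ⟨x, d, hd, rfl⟩
    have h1 := hsub x d hd
    have e : ⟪v, x - q⟫_ℝ = ⟪v, u - q⟫_ℝ + ⟪v, x - u⟫_ℝ := by rw [← inner_add_right]; congr 1; abel
    have h2 : 0 ≤ s * ‖x - u‖ ^ 2 + ⟪v, x - u⟫_ℝ + ‖v‖ ^ 2 / (4 * s) := by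
      have h3 := neg_le_of_abs_le (abs_real_inner_le_norm v (x - u))
      have h4 : s * ‖x - u‖ ^ 2 - ‖v‖ * ‖x - u‖ + ‖v‖ ^ 2 / (4 * s)
          = s * (‖x - u‖ - ‖v‖ / (2 * s)) ^ 2 := by field_simp; ring
      have h5 : 0 ≤ s * (‖x - u‖ - ‖v‖ / (2 * s)) ^ 2 := by positivity
      linarith
    linarith
  set I := sInf V
  have hI : ∀ r ∈ V, I ≤ r := fun r hr => csInf_le hVbdd hr
  have hseq : ∀ n : ℕ, ∃ (x : H) (d : ℝ), g x = d ∧ s * ‖x - u‖ ^ 2 + d < I + 1 / ((n : ℝ) + 1) := by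
    intro n
    obtain ⟨r, ⟨x, d, hd, rfl⟩, hr⟩ := exists_lt_of_csInf_lt hVne
      (show sInf V < I + 1 / ((n : ℝ) + 1) from lt_add_of_pos_right _ (by positivity))
    exact ⟨x, d, hd, hr⟩
  choose x d hxd hlt using hseq
  have hlim0 : Tendsto (fun n : ℕ => 1 / ((n : ℝ) + 1)) atTop (𝓝 0) :=
    tendsto_one_div_add_atTop_nhds_zero_nat
  -- By the parallelogram law the midpoint beats the average of two objective values by s/4 · ‖x m -
  -- x n‖², yet cannot go below the infimum. Hence a minimizing sequence is Cauchy.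
  have hpair : ∀ m n : ℕ, s / 4 * ‖x m - x n‖ ^ 2 ≤ (1 / ((m : ℝ) + 1) + 1 / ((n : ℝ) + 1)) / 2 := by
    intro m n
    obtain ⟨r, hr, hrle⟩ := convex_real hg.1 hconv (hxd m).le (hxd n).le
      (one_half_pos (α := ℝ)) (one_half_pos (α := ℝ)) (by norm_num)
    have h1 := hI _ ⟨_, r, hr, rfl⟩
    have hpar := parallelogram_law_with_norm ℝ (x m - u) (x n - u)
    have e1 : x m - u - (x n - u) = x m - x n := by abel
    have e2 : (1 / 2 : ℝ) • x m + (1 / 2 : ℝ) • x n - u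
        = (1 / 2 : ℝ) • ((x m - u) + (x n - u)) := by module
    rw [e1] at hpar
    rw [e2, norm_smul, mul_pow] at h1
    norm_num at h1
    have hm := hlt m
    have hn := hlt n
    have e3 : ‖x m - u + (x n - u)‖ ^ 2
      = 2 * (‖x m - u‖ ^ 2 + ‖x n - u‖ ^ 2) - ‖x m - x n‖ ^ 2 := by linarith
    rw [e3] at h1
    linarith
  have hcauchy : CauchySeq x := by
    refine Metric.cauchySeq_iff'.2 fun ε hε => ?_
    have hpos : 0 < s / 4 * ε ^ 2 := by positivity
    obtain ⟨N, hN⟩ := exists_nat_one_div_lt hpos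
    refine ⟨N, fun n hn => ?_⟩
    have h1 := hpair n N
    have h2 : 1 / ((n : ℝ) + 1) ≤ 1 / ((N : ℝ) + 1) := by gcongr
    rw [dist_eq_norm]
    have h3 : s / 4 * ‖x n - x N‖ ^ 2 < s / 4 * ε ^ 2 := by linarith
    exact lt_of_pow_lt_pow_left₀ 2 hε.le (lt_of_mul_lt_mul_left h3 (by positivity))
  obtain ⟨p, hp⟩ := cauchySeq_tendsto_of_complete hcauchy
  have hnorm : Tendsto (fun n => s * ‖x n - u‖ ^ 2) atTop (𝓝 (s * ‖p - u‖ ^ 2)) :=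
    (((hp.sub_const u).norm).pow 2).const_mul s
  have hgp : g p ≤ ((I - s * ‖p - u‖ ^ 2 : ℝ) : EReal) := by
    have hbound : Tendsto (fun n : ℕ => I + 1 / ((n : ℝ) + 1) - s * ‖x n - u‖ ^ 2) atTop
        (𝓝 (I + 0 - s * ‖p - u‖ ^ 2)) := (hlim0.const_add I).sub hnorm
    rw [add_zero] at hbound
    -- For each larger real r, the sublevel set {g ≤ r} is closed by lower semicontinuity and
    -- eventually contains x n.
    refine EReal.le_of_forall_lt_iff_le.1 fun r hr => ?_
    have hr' : I - s * ‖p - u‖ ^ 2 < r := by exact_mod_cast hr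
    refine (hlsc.isClosed_preimage (r : EReal)).mem_of_tendsto hp ?_
    filter_upwards [hbound.eventually_lt_const hr'] with n hn
    simp only [Set.mem_preimage, Set.mem_Iic, hxd n, EReal.coe_le_coe_iff]
    linarith [hlt n]
  refine ⟨p, fun y => ?_⟩
  have hpr : objective (fun x => s * ‖x - u‖ ^ 2) g p ≤ (I : EReal) := by
    calc ((s * ‖p - u‖ ^ 2 : ℝ) : EReal) + g p
        ≤ ((s * ‖p - u‖ ^ 2 : ℝ) : EReal) + ((I - s * ‖p - u‖ ^ 2 : ℝ) : EReal) := by gcongr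
      _ = I := by rw [← EReal.coe_add]; congr 1; ring
  refine hpr.trans ?_
  rcases eq_or_ne (g y) ⊤ with hy | hy
  · simp only [objective, hy, EReal.coe_add_top, le_top]
  · lift g y to ℝ using ⟨hy, hg.1 y⟩ with e he
    simp only [objective, ← he]
    exact_mod_cast hI _ ⟨y, e, he.symm, rfl⟩

lemma hasGradientAt_sq_dist [CompleteSpace H] {γ : ℝ} (hγ : 0 < γ) (u p : H) :
    HasGradientAt (fun x : H => 1 / (2 * γ) * ‖x - u‖ ^ 2) ((1 / γ) • (p - u)) p := by
  rw [hasGradientAt_iff_hasFDerivAt]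
  have h := (((hasFDerivAt_id p).sub_const u).norm_sq).const_mul (1 / (2 * γ))
  refine h.congr_fderiv ?_
  ext y
  simp
  field_simp

/-- The resolvent characterization of the proximity operator. -/
lemma isSubgradient_prox [CompleteSpace H] {g : H → EReal} (hg : IsProper g)
    (hconv : IsConvex g) (hlsc : LowerSemicontinuous g) {q v : H} (hq : IsSubgradient g q v)
    {γ : ℝ} (hγ : 0 < γ) (u : H) :
    IsSubgradient g (prox γ g u) ((1 / γ) • (u - prox γ g u)) := by
  have hmem : prox γ g u ∈ argmin (objective (fun x => 1 / (2 * γ) * ‖x - u‖ ^ 2) g) :=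
    Classical.epsilon_spec (exists_mem_argmin_prox hg hconv hlsc hq hγ u)
  have h := isSubgradient_of_mem_argmin hg hconv (hasGradientAt_sq_dist hγ u _) hmem
  rwa [← smul_neg, neg_sub] at h

/-- The resolvent of a subdifferential is firmly nonexpansive. -/
lemma resolvent_firm {g : H → EReal} {γ : ℝ} (hγ : 0 < γ) {p q u v : H}
    (hp : IsSubgradient g p ((1 / γ) • (u - p))) (hq : IsSubgradient g q ((1 / γ) • (v - q))) :
    0 ≤ ⟪p - q, (u - p) - (v - q)⟫_ℝ := by
  have h := hp.monotone hq
  rw [← smul_sub, inner_smul_right] at h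
  exact nonneg_of_mul_nonneg_right h (by positivity)

lemma resolvent_nonexpansive {g : H → EReal} {γ : ℝ} (hγ : 0 < γ) {p q u v : H}
    (hp : IsSubgradient g p ((1 / γ) • (u - p))) (hq : IsSubgradient g q ((1 / γ) • (v - q))) :
    ‖p - q‖ ≤ ‖u - v‖ := by
  have h := resolvent_firm hγ hp hq
  have e : (u - p) - (v - q) = (u - v) - (p - q) := by abel
  rw [e, inner_sub_right, real_inner_self_eq_norm_sq] at h
  have h2 := real_inner_le_norm (p - q) (u - v)
  by_contra! hlt
  nlinarith [norm_nonneg (p - q), norm_nonneg (u - v)]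

end Prox

/-! ### Weak limits, Opial's lemma and demiclosedness -/

section WeakConvergence

variable {H : Type*} [NormedAddCommGroup H] [InnerProductSpace ℝ H]

/-- Weak convergence in a Hilbert space, tested against inner products. -/
def WeakLim {ι : Type*} (x : ι → H) (l : Filter ι) (p : H) : Prop :=
  ∀ h : H, Tendsto (fun k => ⟪x k, h⟫_ℝ) l (𝓝 ⟪p, h⟫_ℝ)

/-- A bounded family converges weakly along every ultrafilter. -/
lemma exists_weakLim [CompleteSpace H] {ι : Type*} (U : Ultrafilter ι) {x : ι → H} {C : ℝ}
    (hC : ∀ k, ‖x k‖ ≤ C) : ∃ p, WeakLim x U p := by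
  have hlim : ∀ h : H, ∃ l : ℝ, |l| ≤ C * ‖h‖ ∧ Tendsto (fun k => ⟪x k, h⟫_ℝ) U (𝓝 l) := by
    intro h
    obtain ⟨l, hl, hle⟩ := (isCompact_Icc (a := -(C * ‖h‖)) (b := C * ‖h‖)).ultrafilter_le_nhds
      (U.map fun k => ⟪x k, h⟫_ℝ) (by
        rw [le_principal_iff]
        refine mem_map.2 (univ_mem' fun k => ?_)
        refine abs_le.1 ((abs_real_inner_le_norm _ _).trans ?_)
        gcongr
        exact hC k)
    exact ⟨l, abs_le.2 hl, hle⟩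
  choose ℓ hbd hℓ using hlim
  -- Limits along the ultrafilter, which exist by compactness, depend linearly on h and are bounded
  -- by C‖h‖; Riesz representation yields the weak limit.
  let L : H →ₗ[ℝ] ℝ :=
    { toFun := ℓ
      map_add' := fun h h' => tendsto_nhds_unique (hℓ (h + h'))
        (by simpa only [inner_add_right] using (hℓ h).add (hℓ h'))
      map_smul' := fun c h => tendsto_nhds_unique (hℓ (c • h))
        (by simpa only [inner_smul_right, RingHom.id_apply, smul_eq_mul] using (hℓ h).const_mul c) }
  refine ⟨(InnerProductSpace.toDual ℝ H).symm (L.mkContinuous C hbd), fun h => ?_⟩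
  rw [InnerProductSpace.toDual_symm_apply]
  exact hℓ h

/-- Opial's lemma. -/
lemma exists_weakLim_of_tendsto_dist [CompleteSpace H] {x : ℕ → H} {S : Set H} {C : ℝ}
    (hC : ∀ k, ‖x k‖ ≤ C)
    (hdist : ∀ p ∈ S, ∃ l : ℝ, Tendsto (fun k => ‖x k - p‖) atTop (𝓝 l))
    (hcluster : ∀ (U : Ultrafilter ℕ) (p : H), ↑U ≤ (atTop : Filter ℕ) → WeakLim x U p → p ∈ S) :
    ∃ p ∈ S, WeakLim x atTop p := by
  have huniq : ∀ (U V : Ultrafilter ℕ) (p q : H), ↑U ≤ (atTop : Filter ℕ) →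
      ↑V ≤ (atTop : Filter ℕ) → WeakLim x U p → WeakLim x V q → p = q := by
    intro U V p q hU hV hp hq
    obtain ⟨l, hl⟩ := hdist p (hcluster U p hU hp)
    obtain ⟨m, hm⟩ := hdist q (hcluster V q hV hq)
    -- Since ‖x - q‖² - ‖x - p‖² is affine in x with linear part 2⟪x, p - q⟫, convergence of both
    -- distances forces these inner products to converge along the whole sequence, so both
    -- ultrafilters see the same limit.
    have hconv : Tendsto (fun k => ⟪x k, p - q⟫_ℝ) atTop
        (𝓝 ((m ^ 2 - l ^ 2 + (‖p‖ ^ 2 - ‖q‖ ^ 2)) / 2)) := by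
      refine ((((hm.pow 2).sub (hl.pow 2)).add_const (‖p‖ ^ 2 - ‖q‖ ^ 2)).div_const 2).congr ?_
      intro k
      rw [norm_sub_sq_real, norm_sub_sq_real, inner_sub_right]
      ring
    have h1 := tendsto_nhds_unique (hp (p - q)) (hconv.mono_left hU)
    have h2 := tendsto_nhds_unique (hq (p - q)) (hconv.mono_left hV)
    have h3 : ⟪p - q, p - q⟫_ℝ = 0 := by rw [inner_sub_left, h1, h2, sub_self]
    exact sub_eq_zero.1 (inner_self_eq_zero.1 h3)
  have hof : ↑(Ultrafilter.of (atTop : Filter ℕ)) ≤ (atTop : Filter ℕ) := Ultrafilter.of_le _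
  obtain ⟨p, hp⟩ := exists_weakLim (Ultrafilter.of (atTop : Filter ℕ)) hC
  refine ⟨p, hcluster _ p hof hp, fun h => ?_⟩
  rw [tendsto_iff_ultrafilter]
  intro U hU
  obtain ⟨q, hq⟩ := exists_weakLim U hC
  rw [huniq _ U p q hof hU hp hq]
  exact hq h

/-- Demiclosedness principle: `I - T` is demiclosed at `0` for `T` nonexpansive. -/
lemma WeakLim.fixedPoint {ι : Type*} {l : Filter ι} [l.NeBot] {T : H → H}
    (hT : ∀ x y, ‖T x - T y‖ ≤ ‖x - y‖) {x : ι → H} {p : H} {C : ℝ} (hC : ∀ k, ‖x k‖ ≤ C)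
    (hx : WeakLim x l p) (hTx : Tendsto (fun k => ‖T (x k) - x k‖) l (𝓝 0)) : T p = p := by
  -- Expand ‖x k - T p‖² around p, and compare with ‖x k - T p‖ ≤ ‖T (x k) - x k‖ + ‖x k - p‖. The
  -- terms ‖x k - p‖² cancel, and the rest of the right side tends to 0.
  have hineq : ∀ k, ‖p - T p‖ ^ 2 ≤ ‖T (x k) - x k‖ * (‖T (x k) - x k‖ + 2 * (C + ‖p‖))
      - 2 * (⟪x k, p - T p⟫_ℝ - ⟪p, p - T p⟫_ℝ) := by
    intro k
    have h1 : ‖x k - T p‖ ≤ ‖T (x k) - x k‖ + ‖x k - p‖ := by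
      calc ‖x k - T p‖ = ‖(x k - T (x k)) + (T (x k) - T p)‖ := by congr 1; abel
        _ ≤ ‖x k - T (x k)‖ + ‖T (x k) - T p‖ := norm_add_le _ _
        _ ≤ _ := by rw [norm_sub_rev (x k)]; gcongr; exact hT _ _
    have h2 : ‖x k - T p‖ ^ 2
        = ‖x k - p‖ ^ 2 + 2 * (⟪x k, p - T p⟫_ℝ - ⟪p, p - T p⟫_ℝ) + ‖p - T p‖ ^ 2 := by
      rw [← inner_sub_left, ← norm_add_sq_real]
      congr 2
      abel
    have h3 : ‖x k - p‖ ≤ C + ‖p‖ := (norm_sub_le _ _).trans (by gcongr; exact hC k)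
    have h4 : ‖x k - T p‖ ^ 2 ≤ (‖T (x k) - x k‖ + ‖x k - p‖) ^ 2 := by gcongr
    nlinarith [norm_nonneg (T (x k) - x k)]
  have hlim : Tendsto (fun k => ‖T (x k) - x k‖ * (‖T (x k) - x k‖ + 2 * (C + ‖p‖))
      - 2 * (⟪x k, p - T p⟫_ℝ - ⟪p, p - T p⟫_ℝ)) l
      (𝓝 (0 * (0 + 2 * (C + ‖p‖)) - 2 * (⟪p, p - T p⟫_ℝ - ⟪p, p - T p⟫_ℝ))) :=
    (hTx.mul (hTx.add_const _)).sub (((hx (p - T p)).sub_const _).const_mul 2)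
  have h0 := ge_of_tendsto hlim (Eventually.of_forall hineq)
  simp only [zero_mul, sub_self, mul_zero] at h0
  have h1 : ‖p - T p‖ = 0 := pow_eq_zero_iff two_ne_zero |>.1 (le_antisymm h0 (by positivity))
  exact (sub_eq_zero.1 (norm_eq_zero.1 h1)).symm

lemma WeakLim.add_tendsto_zero {ι : Type*} {l : Filter ι} {x y : ι → H} {p : H}
    (hx : WeakLim x l p) (hy : Tendsto (fun k => ‖y k - x k‖) l (𝓝 0)) : WeakLim y l p := by
  intro h
  have h1 : Tendsto (fun k => ⟪y k - x k, h⟫_ℝ) l (𝓝 0) := by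
    refine squeeze_zero_norm (fun k => norm_inner_le_norm (𝕜 := ℝ) (y k - x k) h) ?_
    simpa using hy.mul_const ‖h‖
  refine (by simpa using (hx h).add h1 : Tendsto _ l (𝓝 ⟪p, h⟫_ℝ)).congr fun k => ?_
  rw [inner_sub_left]
  ring

lemma WeakLim.tendsto_toWeakSpace [CompleteSpace H] {ι : Type*} {l : Filter ι} {x : ι → H} {p : H}
    (hx : WeakLim x l p) :
    Tendsto (fun k => toWeakSpace ℝ H (x k)) l (𝓝 (toWeakSpace ℝ H p)) := by
  have hinj : Function.Injective (topDualPairing ℝ H).flip := by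
    intro u v huv
    refine ext_inner_left ℝ fun w => ?_
    simpa using congrArg (fun L => L (InnerProductSpace.toDual ℝ H w)) huv
  have heval : ∀ L : StrongDual ℝ H, Tendsto (fun k => L (x k)) l (𝓝 (L p)) := by
    intro L
    have e : ∀ u : H, ⟪u, (InnerProductSpace.toDual ℝ H).symm L⟫_ℝ = L u := fun u => by
      rw [real_inner_comm, InnerProductSpace.toDual_symm_apply]
    simpa only [e] using hx ((InnerProductSpace.toDual ℝ H).symm L)
  exact (WeakBilin.tendsto_iff_forall_eval_tendsto _ hinj).2 heval

end WeakConvergence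

/-! ### Inertial recursions for real sequences -/

section RealSequences

/-- Summing the recursion gives S ≤ p 0 + aS + ∑ε for each partial sum S of p, and a < 1 lets aS be
absorbed. -/
lemma summable_of_le_mul_add {p ε : ℕ → ℝ} {a : ℝ} (ha : a < 1) (hp : ∀ n, 0 ≤ p n)
    (hε : ∀ n, 0 ≤ ε n) (hsum : Summable ε) (hrec : ∀ n, p (n + 1) ≤ a * p n + ε n) :
    Summable p := by
  refine summable_of_sum_range_le (c := (p 0 + ∑' i, ε i) / (1 - a)) hp fun n => ?_
  rw [le_div_iff₀ (sub_pos.2 ha)]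
  have h1 : ∑ i ∈ Finset.range n, p (i + 1) ≤ ∑ i ∈ Finset.range n, (a * p i + ε i) :=
    Finset.sum_le_sum fun i _ => hrec i
  rw [Finset.sum_add_distrib, ← Finset.mul_sum] at h1
  have h2 := hsum.sum_le_tsum (Finset.range n) fun i _ => hε i
  have h3 : ∑ i ∈ Finset.range n, p i ≤ ∑ i ∈ Finset.range n, p (i + 1) + p 0 := by
    rw [← Finset.sum_range_succ']
    rw [Finset.sum_range_succ]
    linarith [hp n]
  linarith

/-- Subtracting the accumulated positive increments from φ leaves an antitone sequence that is
bounded below. -/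
lemma exists_tendsto_of_summable_posPart {φ : ℕ → ℝ} (hφ : ∀ n, 0 ≤ φ n)
    (hsum : Summable fun n => max (φ (n + 1) - φ n) 0) : ∃ l, Tendsto φ atTop (𝓝 l) := by
  set S : ℕ → ℝ := fun n => ∑ i ∈ Finset.range n, max (φ (i + 1) - φ i) 0 with hS
  have hSlim : Tendsto S atTop (𝓝 _) := hsum.hasSum.tendsto_sum_nat
  have hanti : Antitone fun n => φ n - S n := antitone_nat_of_succ_le fun n => by
    simp only [hS, Finset.sum_range_succ]
    linarith [le_max_left (φ (n + 1) - φ n) 0]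
  have hbdd : BddBelow (Set.range fun n => φ n - S n) := by
    refine ⟨-∑' n, max (φ (n + 1) - φ n) 0, ?_⟩
    rintro _ ⟨n, rfl⟩
    have := hsum.sum_le_tsum (Finset.range n) fun i _ => le_max_right _ _
    simp only [hS]
    linarith [hφ n]
  exact ⟨_, ((tendsto_atTop_ciInf hanti hbdd).add hSlim).congr fun n => by simp⟩

/-- The positive parts of the increments are summable in an inertial Fejér-type recursion. -/
lemma summable_increments {φ α ι ε c : ℕ → ℝ} {a : ℝ} (hα : ∀ n, 0 ≤ α n ∧ α n ≤ a) (ha : a < 1)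
    (hι : ∀ n, 0 ≤ ι n) (hε : ∀ n, 0 ≤ ε n) (hc : ∀ n, 0 ≤ c n)
    (hιs : Summable ι) (hεs : Summable ε)
    (hrec : ∀ n, φ (n + 2) ≤ (1 + α n) * φ (n + 1) - α n * φ n + ι n + ε n - c n) :
    Summable fun n => max (φ (n + 1) - φ n) 0 := by
  refine summable_of_le_mul_add ha (fun n => le_max_right _ _)
    (fun n => add_nonneg (hι n) (hε n)) (hιs.add hεs) fun n => ?_
  have h0 := le_max_right (φ (n + 1) - φ n) 0
  have h1 : α n * (φ (n + 1) - φ n) ≤ a * max (φ (n + 1) - φ n) 0 :=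
    (mul_le_mul_of_nonneg_left (le_max_left _ _) (hα n).1).trans
      (mul_le_mul_of_nonneg_right (hα n).2 h0)
  have h2 : 0 ≤ a * max (φ (n + 1) - φ n) 0 := mul_nonneg ((hα n).1.trans (hα n).2) h0
  refine max_le ?_ (by linarith [hι n, hε n])
  linarith [hrec n, hc n]

/-- Summing an inertial Fejér-type recursion bounds the decrease terms. -/
lemma sum_decrease_le {φ α ι ε c : ℕ → ℝ} {a : ℝ} (hα : ∀ n, 0 ≤ α n ∧ α n ≤ a)
    (hφ : ∀ n, 0 ≤ φ n) (hι : ∀ n, 0 ≤ ι n) (hε : ∀ n, 0 ≤ ε n)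
    (hp : Summable fun n => max (φ (n + 1) - φ n) 0) (hιs : Summable ι) (hεs : Summable ε)
    (hrec : ∀ n, φ (n + 2) ≤ (1 + α n) * φ (n + 1) - α n * φ n + ι n + ε n - c n) (k : ℕ) :
    ∑ i ∈ Finset.range k, c (i + 1) ≤
      φ 2 + (a * ∑' i, max (φ (i + 2) - φ (i + 1)) 0 + ∑' i, ε (i + 1) + ∑' i, ι (i + 1)) := by
  have hterm : ∀ i, c (i + 1) ≤ (φ (i + 2) - φ (i + 1 + 2))
      + (a * max (φ (i + 2) - φ (i + 1)) 0 + ε (i + 1) + ι (i + 1)) := by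
    intro i
    have h0 := le_max_right (φ (i + 2) - φ (i + 1)) 0
    have h1 : α (i + 1) * (φ (i + 2) - φ (i + 1)) ≤ a * max (φ (i + 2) - φ (i + 1)) 0 :=
      (mul_le_mul_of_nonneg_left (le_max_left _ _) (hα _).1).trans
        (mul_le_mul_of_nonneg_right (hα _).2 h0)
    have h2 := hrec (i + 1)
    have e : i + 1 + 1 = i + 2 := rfl
    rw [e] at h2
    linarith
  have hsum := Finset.sum_le_sum fun i (_ : i ∈ Finset.range k) => hterm i
  have htel : ∑ i ∈ Finset.range k, (φ (i + 2) - φ (i + 1 + 2)) = φ 2 - φ (k + 2) :=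
    Finset.sum_range_sub' (fun i => φ (i + 2)) k
  rw [Finset.sum_add_distrib, Finset.sum_add_distrib, Finset.sum_add_distrib, htel,
    ← Finset.mul_sum] at hsum
  have hp' : Summable fun i => max (φ (i + 2) - φ (i + 1)) 0 := (summable_nat_add_iff 1).2 hp
  have h1 := hp'.sum_le_tsum (Finset.range k) fun i _ => le_max_right _ _
  have h2 := ((summable_nat_add_iff 1).2 hεs).sum_le_tsum (Finset.range k) fun i _ => hε _
  have h3 := ((summable_nat_add_iff 1).2 hιs).sum_le_tsum (Finset.range k) fun i _ => hι _
  have ha : 0 ≤ a := (hα 0).1.trans (hα 0).2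
  have h4 := mul_le_mul_of_nonneg_left h1 ha
  linarith [hφ (k + 2)]

/-- Lyapunov argument for nondecreasing inertial parameters. -/
lemma summable_of_lyapunov {φ α D ε : ℕ → ℝ} {a G σ C : ℝ} (hα : ∀ n, 0 ≤ α n ∧ α n ≤ a)
    (hmono : Monotone α) (hG : 0 ≤ G) (hσ : 0 < σ) (hφ : ∀ n, 0 ≤ φ n) (hφC : ∀ n, φ n ≤ C)
    (hD : ∀ n, 0 ≤ D n) (hε : ∀ n, 0 ≤ ε n) (hεs : Summable ε)
    (hrec : ∀ n, φ (n + 2) ≤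
      (1 + α n) * φ (n + 1) - α n * φ n + G * D n - (G + σ) * D (n + 1) + ε n) :
    Summable D := by
  -- Monotonicity of α replaces α n by α (n + 1) in front of φ (n + 1), so Ψ drops by σ D (n + 1) up
  -- to the error. Boundedness of φ keeps Ψ above -aC.
  set Ψ : ℕ → ℝ := fun n => φ (n + 1) - α n * φ n + G * D n with hΨ
  have hstep : ∀ n, σ * D (n + 1) ≤ (Ψ n - Ψ (n + 1)) + ε n := by
    intro n
    have h1 := mul_le_mul_of_nonneg_right (hmono n.le_succ) (hφ (n + 1))
    have h2 := hrec n
    simp only [hΨ, Nat.succ_eq_add_one] at h1 ⊢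
    linarith
  have hlow : ∀ n, -(a * C) ≤ Ψ n := by
    intro n
    have h1 : α n * φ n ≤ a * C :=
      mul_le_mul (hα n).2 (hφC n) (hφ n) ((hα n).1.trans (hα n).2)
    simp only [hΨ]
    linarith [hφ (n + 1), mul_nonneg hG (hD n)]
  rw [← summable_nat_add_iff 1]
  refine summable_of_sum_range_le (c := (Ψ 0 + a * C + ∑' i, ε i) / σ) (fun n => hD _) fun n => ?_
  rw [le_div_iff₀ hσ, Finset.sum_mul]
  have h1 := Finset.sum_le_sum fun i (_ : i ∈ Finset.range n) => hstep i
  rw [Finset.sum_add_distrib, Finset.sum_range_sub'] at h1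
  have h2 := hεs.sum_le_tsum (Finset.range n) fun i _ => hε i
  simp only [mul_comm σ] at h1
  linarith [hlow n]

/-- This is where the form of `lamBar` comes from. With Q = a(1 + a) + aδ + σ, the bound on l is a
rearrangement of (a + δl)Q ≤ δ(1 - l). It is applied with A = ‖z^{k+1} - z^k‖, B = ‖z^k - z^{k-1}‖
and l = λ_k/κ. -/
lemma relaxation_quadratic_bound {a α δ σ l A B : ℝ} (hα : 0 ≤ α) (hαa : α ≤ a) (hδ : 0 < δ)
    (hσ : 0 < σ) (hl : 0 < l)
    (hle : l ≤ (δ - a * (a * (1 + a) + a * δ + σ)) / (δ * (1 + a * (1 + a) + a * δ + σ))) :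
    (a * (1 + a) + a * δ + σ) * A ^ 2 - (a * (1 + a) + a * δ - α * (1 + α)) * B ^ 2 ≤
      (1 - l) / l * (A ^ 2 - 2 * α * (A * B) + α ^ 2 * B ^ 2) := by
  have ha : 0 ≤ a := hα.trans hαa
  set Q := a * (1 + a) + a * δ + σ with hQ
  have hQ0 : 0 < Q := by positivity
  have hden : 0 < δ * (1 + a * (1 + a) + a * δ + σ) := by positivity
  rw [le_div_iff₀ hden] at hle
  have hle' : l * δ * (1 + Q) ≤ δ - a * Q := by rw [hQ] at *; linarith
  -- Young weight for the cross term: 1 - α/m = δl/m and α² - αm = -αδl, so a factor l comes out of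
  -- both coefficients and cancels the 1/l in front.
  set m := α + δ * l with hm
  have hm0 : 0 < m := by positivity
  have hmQ : m * Q ≤ δ * (1 - l) := by
    have := mul_le_mul_of_nonneg_right hαa hQ0.le
    rw [hm]; linarith
  have hl1 : 0 ≤ 1 - l := by
    have h1 : 0 ≤ δ * (1 - l) := (by positivity : 0 ≤ m * Q).trans hmQ
    exact nonneg_of_mul_nonneg_right h1 hδ
  have hyoung : 2 * (A * B) ≤ A ^ 2 / m + m * B ^ 2 := by
    have h1 : A ^ 2 / m + m * B ^ 2 - 2 * (A * B) = (A - m * B) ^ 2 / m := by field_simp; ring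
    have h2 : 0 ≤ (A - m * B) ^ 2 / m := by positivity
    linarith
  have h1 : A ^ 2 - α * (A ^ 2 / m + m * B ^ 2) + α ^ 2 * B ^ 2
      ≤ A ^ 2 - 2 * α * (A * B) + α ^ 2 * B ^ 2 := by
    have := mul_le_mul_of_nonneg_left hyoung hα
    linarith
  have h2 := mul_le_mul_of_nonneg_left h1 (div_nonneg hl1 hl.le)
  refine le_trans ?_ h2
  have h3 : (1 - l) / l * (A ^ 2 - α * (A ^ 2 / m + m * B ^ 2) + α ^ 2 * B ^ 2)
      = δ * (1 - l) / m * A ^ 2 - α * (δ * (1 - l)) * B ^ 2 := by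
    have e : A ^ 2 - α * (A ^ 2 / m + m * B ^ 2) + α ^ 2 * B ^ 2
        = l * (δ / m * A ^ 2 - α * δ * B ^ 2) := by
      have : α = m - δ * l := by rw [hm]; ring
      rw [this]; field_simp; ring
    rw [e]; field_simp
  rw [h3]
  have h4 : Q ≤ δ * (1 - l) / m := by rw [le_div_iff₀ hm0]; linarith
  have h5 : α * (1 + α) + α * (δ * (1 - l)) ≤ a * (1 + a) + a * δ := by
    have h6 : δ * (1 - l) ≤ δ := by nlinarith
    have h7 : α * (δ * (1 - l)) ≤ a * δ :=
      mul_le_mul hαa h6 (mul_nonneg hδ.le hl1) ha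
    nlinarith
  have h6 := mul_le_mul_of_nonneg_right h4 (sq_nonneg A)
  have h7 := mul_le_mul_of_nonneg_right h5 (sq_nonneg B)
  linarith

end RealSequences

/-! ### The relaxed step and the forward-backward operator -/

section ForwardBackward

variable {H : Type*} [NormedAddCommGroup H] [InnerProductSpace ℝ H]

lemma norm_inertial_sub_sq (p q s : H) (t : ℝ) :
    ‖p + t • (p - q) - s‖ ^ 2
      = (1 + t) * ‖p - s‖ ^ 2 - t * ‖q - s‖ ^ 2 + t * (1 + t) * ‖p - q‖ ^ 2 := by
  have e1 : p + t • (p - q) - s = (p - s) + t • ((p - s) - (q - s)) := by module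
  have e2 : p - q = (p - s) - (q - s) := by abel
  rw [e1, e2]
  generalize p - s = u
  generalize q - s = v
  rw [norm_add_sq_real, norm_smul, inner_smul_right, mul_pow, Real.norm_eq_abs, sq_abs,
    norm_sub_sq_real, inner_sub_right, real_inner_self_eq_norm_sq]
  ring

lemma norm_sub_smul_sq_ge (v w : H) {t : ℝ} (ht : 0 ≤ t) :
    ‖v‖ ^ 2 - 2 * t * (‖v‖ * ‖w‖) + t ^ 2 * ‖w‖ ^ 2 ≤ ‖v - t • w‖ ^ 2 := by
  rw [norm_sub_sq_real, inner_smul_right, norm_smul, mul_pow, Real.norm_eq_abs, sq_abs]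
  have := mul_le_mul_of_nonneg_left (real_inner_le_norm v w) ht
  linarith

/-- One relaxed and perturbed step `x ↦ x + l • (y + e - x)` towards `y = T x`. -/
lemma relaxed_step_le {x y s e : H} {κ l : ℝ} (hl : 0 ≤ l)
    (h : κ * ‖y - x‖ ^ 2 ≤ 2 * ⟪x - y, x - s⟫_ℝ) :
    ‖x + l • (y + e - x) - s‖ ^ 2 ≤ ‖x - s‖ ^ 2 - l * (κ - l) * ‖y - x‖ ^ 2
      + 2 * ‖x + l • (y + e - x) - s‖ * l * ‖e‖ := by
  set w := x + l • (y + e - x) - s with hw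
  have e1 : w - l • e = (x - s) - l • (x - y) := by rw [hw]; module
  have h1 : ‖w - l • e‖ ^ 2 = ‖x - s‖ ^ 2 - 2 * l * ⟪x - y, x - s⟫_ℝ + l ^ 2 * ‖y - x‖ ^ 2 := by
    rw [e1, norm_sub_sq_real, norm_smul, mul_pow, Real.norm_eq_abs, sq_abs, inner_smul_right,
      norm_sub_rev x y, real_inner_comm]
    ring
  -- Expanding around the perturbed point w puts the new iterate's distance into the error term and
  -- gives l²‖e‖² a sign that allows dropping it.
  have h2 : ‖w‖ ^ 2 ≤ ‖w - l • e‖ ^ 2 + 2 * ‖w‖ * l * ‖e‖ := by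
    have h3 : 0 ≤ l ^ 2 * ‖e‖ ^ 2 := by positivity
    linarith [norm_sub_smul_sq_ge w e hl]
  have h3 := mul_le_mul_of_nonneg_left h hl
  linarith

variable [CompleteSpace H] {β ρ : ℝ} {f : H → ℝ} {g : H → EReal}

lemma isSubgradient_neg_gradient (hf_diff : Differentiable ℝ f) (hg : IsProper g)
    (hconv : IsConvex g) {s : H} (hs : s ∈ argmin (objective f g)) :
    IsSubgradient g s (-∇ f s) :=
  isSubgradient_of_mem_argmin hg hconv (hf_diff s).hasGradientAt hs

lemma prox_nonexpansive (hρ : 0 < ρ) (hg : IsProper g) (hconv : IsConvex g)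
    (hlsc : LowerSemicontinuous g) {q w : H} (hq : IsSubgradient g q w) (u v : H) :
    ‖prox ρ g u - prox ρ g v‖ ≤ ‖u - v‖ :=
  resolvent_nonexpansive hρ (isSubgradient_prox hg hconv hlsc hq hρ u)
    (isSubgradient_prox hg hconv hlsc hq hρ v)

/-- Fixed points of the forward-backward operator minimize `f + g`. -/
lemma mem_argmin_of_fbOp_eq (hρ : 0 < ρ) (hf_convex : ConvexOn ℝ Set.univ f)
    (hf_diff : Differentiable ℝ f) (hg : IsProper g) (hconv : IsConvex g)
    (hlsc : LowerSemicontinuous g) {q w : H} (hq : IsSubgradient g q w) {p : H}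
    (hp : fbOp ρ f g p = p) : p ∈ argmin (objective f g) := by
  have h := isSubgradient_prox hg hconv hlsc hq hρ (p - ρ • ∇ f p)
  have hp' : prox ρ g (p - ρ • ∇ f p) = p := hp
  have e : (1 / ρ) • (p - ρ • ∇ f p - p) = -∇ f p := by
    rw [sub_sub_cancel_left, smul_neg, smul_smul, one_div_mul_cancel hρ.ne', one_smul]
  rw [hp', e] at h
  exact h.mem_argmin hg.1 fun y => tangent_le_of_convexOn hf_convex (hf_diff p).hasGradientAt y

/-- Cocoercivity makes the forward step lose ρ(2β - ρ)‖∇f x - ∇f y‖², which is nonnegative because ρ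
< 2β; the backward step is nonexpansive. -/
lemma fbOp_nonexpansive (hβ : 0 < β) (hρ : 0 < ρ) (hρβ : ρ < 2 * β)
    (hf_convex : ConvexOn ℝ Set.univ f) (hf_diff : Differentiable ℝ f)
    (hf_lip : ∀ x y, ‖∇ f x - ∇ f y‖ ≤ 1 / β * ‖x - y‖) (hg : IsProper g) (hconv : IsConvex g)
    (hlsc : LowerSemicontinuous g) {q w : H} (hq : IsSubgradient g q w) (x y : H) :
    ‖fbOp ρ f g x - fbOp ρ f g y‖ ≤ ‖x - y‖ := by
  refine (prox_nonexpansive hρ hg hconv hlsc hq _ _).trans ?_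
  have hcoc := gradient_cocoercive hf_convex hf_diff hβ hf_lip x y
  have e : x - ρ • ∇ f x - (y - ρ • ∇ f y) = (x - y) - ρ • (∇ f x - ∇ f y) := by module
  rw [e]
  refine le_of_sq_le_sq ?_ (norm_nonneg _)
  rw [norm_sub_sq_real, norm_smul, mul_pow, Real.norm_eq_abs, sq_abs, inner_smul_right,
    real_inner_comm]
  have h1 := mul_le_mul_of_nonneg_left hcoc hρ.le
  have h2 : 0 ≤ ρ * (2 * β - ρ) * ‖∇ f x - ∇ f y‖ ^ 2 := by
    have : 0 < 2 * β - ρ := by linarith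
    positivity
  linarith

/-- The forward-backward operator is averaged with constant `2β / (4β - ρ)` relative to the
minimizers of `f + g`. -/
lemma fbOp_quasi_averaged (hβ : 0 < β) (hρ : 0 < ρ)
    (hf_convex : ConvexOn ℝ Set.univ f) (hf_diff : Differentiable ℝ f)
    (hf_lip : ∀ x y, ‖∇ f x - ∇ f y‖ ≤ 1 / β * ‖x - y‖) (hg : IsProper g) (hconv : IsConvex g)
    (hlsc : LowerSemicontinuous g) {s : H} (hs : s ∈ argmin (objective f g)) (x : H) :
    (4 * β - ρ) / (2 * β) * ‖fbOp ρ f g x - x‖ ^ 2 ≤ 2 * ⟪x - fbOp ρ f g x, x - s⟫_ℝ := by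
  have hsub := isSubgradient_neg_gradient hf_diff hg hconv hs
  have e : -∇ f s = (1 / ρ) • (s - ρ • ∇ f s - s) := by
    rw [sub_sub_cancel_left, smul_neg, smul_smul, one_div_mul_cancel hρ.ne', one_smul]
  have h1 := resolvent_firm hρ (isSubgradient_prox hg hconv hlsc hsub hρ (x - ρ • ∇ f x))
    (e ▸ hsub)
  change 0 ≤ ⟪fbOp ρ f g x - s, x - ρ • ∇ f x - fbOp ρ f g x - (s - ρ • ∇ f s - s)⟫_ℝ at h1
  have hcoc := mul_le_mul_of_nonneg_left
    (gradient_cocoercive hf_convex hf_diff hβ hf_lip x s) hρ.le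
  set r := x - fbOp ρ f g x with hr
  set d := ∇ f x - ∇ f s with hd
  have e1 : fbOp ρ f g x - s = (x - s) - r := by rw [hr]; abel
  have e2 : x - ρ • ∇ f x - fbOp ρ f g x - (s - ρ • ∇ f s - s) = r - ρ • d := by
    rw [hr, hd]; module
  have expand : ∀ y r d : H, ⟪y - r, r - ρ • d⟫_ℝ
      = ⟪r, y⟫_ℝ - ρ * ⟪d, y⟫_ℝ - (‖r‖ ^ 2 - ρ * ⟪r, d⟫_ℝ) := fun y r d => by
    rw [inner_sub_left, inner_sub_right, inner_sub_right, inner_smul_right, inner_smul_right,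
      real_inner_self_eq_norm_sq, real_inner_comm r y, real_inner_comm d y]
  rw [e1, e2, expand] at h1
  -- Young's inequality with the weight for which β‖d‖² is exactly what cocoercivity supplies. The
  -- remaining ρ‖r‖²/(4β), doubled, turns the constant 2 into 2 - ρ/(2β) = κ.
  have h2 : 0 ≤ β * ‖d‖ ^ 2 - ⟪r, d⟫_ℝ + ‖r‖ ^ 2 / (4 * β) := by
    have h3 := real_inner_le_norm r d
    have h4 : β * ‖d‖ ^ 2 - ‖r‖ * ‖d‖ + ‖r‖ ^ 2 / (4 * β) = β * (‖d‖ - ‖r‖ / (2 * β)) ^ 2 := by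
      field_simp; ring
    have h5 : 0 ≤ β * (‖d‖ - ‖r‖ / (2 * β)) ^ 2 := by positivity
    linarith
  have h3 := mul_nonneg hρ.le h2
  have e3 : (4 * β - ρ) / (2 * β) * ‖r‖ ^ 2 = 2 * ‖r‖ ^ 2 - 2 * (ρ * (‖r‖ ^ 2 / (4 * β))) := by
    field_simp; ring
  rw [norm_sub_rev, ← hr, e3]
  linarith

end ForwardBackward

/-! ### Bounds on the data of the scheme -/

section Bounds

variable {H : Type*} [NormedAddCommGroup H] {β ρ : ℝ} {α lam : ℕ → ℝ} {e₁ e₂ : ℕ → H} {z : ℤ → H}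

/-- Boundedness is assumed only from index 0 on; enlarging the constant by ‖z (-1)‖ covers the extra
starting point. -/
lemma exists_norm_le (hb : Bornology.IsBounded (Set.range fun k : ℕ => z k)) :
    ∃ C : ℝ, ∀ n : ℕ, ‖z ((n : ℤ) - 1)‖ ≤ C := by
  obtain ⟨C, hC⟩ := hb.exists_norm_le
  refine ⟨max C ‖z (-1)‖, fun n => ?_⟩
  rcases n with _ | n
  · simp
  · have e : ((n + 1 : ℕ) : ℤ) - 1 = n := by push_cast; ring
    rw [e]
    exact (hC _ ⟨n, rfl⟩).trans (le_max_left _ _)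

lemma norm_le_of_bound {C : ℝ} (hC : ∀ n : ℕ, ‖z ((n : ℤ) - 1)‖ ≤ C) (n : ℕ) : ‖z n‖ ≤ C := by
  simpa using hC (n + 1)

lemma ConditionI.summable_inertiaTerm {a lamLow lamUp : ℝ}
    (hc : ConditionI β ρ α lam e₁ e₂ z a lamLow lamUp) : Summable (inertiaTerm α z) := by
  refine Summable.of_nonneg_of_le (fun k => ?_) (fun k => ?_) (hc.summable_inertia.mul_left 2)
  · have := (hc.inertia_bounds k).1
    rw [inertiaTerm]
    positivity
  · have h0 := mul_nonneg (hc.inertia_bounds k).1 (sq_nonneg ‖z k - z (k - 1)‖)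
    have h1 : 1 + α k ≤ 2 := by linarith [(hc.inertia_bounds k).2, hc.a_lt_one]
    rw [inertiaTerm]
    nlinarith [mul_le_mul_of_nonneg_right h1 h0]

end Bounds

/-! ### Estimates along the scheme and weak convergence -/

section Scheme

variable {H : Type*} [NormedAddCommGroup H] [InnerProductSpace ℝ H] [CompleteSpace H]
  {β ρ : ℝ} {f : H → ℝ} {g : H → EReal} {α lam : ℕ → ℝ} {e₁ e₂ : ℕ → H} {z : ℤ → H} {μ : ℕ → H}

lemma IsScheme.step_totalError (hz : IsScheme ρ f g α lam e₁ e₂ z μ) (k : ℕ) :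
    z (k + 1) = μ k + lam k • (fbOp ρ f g (μ k) + totalError ρ f g e₁ e₂ μ k - μ k) := by
  rw [hz.step k, totalError, add_sub_cancel]

lemma norm_totalError_le (hprox : ∀ u v, ‖prox ρ g u - prox ρ g v‖ ≤ ‖u - v‖) (hρ : 0 < ρ)
    (k : ℕ) : ‖totalError ρ f g e₁ e₂ μ k‖ ≤ ρ * ‖e₁ k‖ + ‖e₂ k‖ := by
  have h := hprox (μ k - ρ • (∇ f (μ k) + e₁ k)) (μ k - ρ • ∇ f (μ k))
  have e : μ k - ρ • (∇ f (μ k) + e₁ k) - (μ k - ρ • ∇ f (μ k)) = -(ρ • e₁ k) := by module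
  rw [e, norm_neg, norm_smul, Real.norm_of_nonneg hρ.le] at h
  have e' : totalError ρ f g e₁ e₂ μ k = (prox ρ g (μ k - ρ • (∇ f (μ k) + e₁ k))
      - prox ρ g (μ k - ρ • ∇ f (μ k))) + e₂ k := by rw [totalError, fbOp]; abel
  rw [e']
  exact (norm_add_le _ _).trans (by gcongr)

/-- The basic recursion for the squared distances to a minimizer. -/
lemma IsScheme.sq_dist_le (hz : IsScheme ρ f g α lam e₁ e₂ z μ) {κ : ℝ} {s : H}
    (hquasi : ∀ x, κ * ‖fbOp ρ f g x - x‖ ^ 2 ≤ 2 * ⟪x - fbOp ρ f g x, x - s⟫_ℝ) {k : ℕ}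
    (hlam : 0 ≤ lam k) :
    ‖z (k + 1) - s‖ ^ 2 ≤ (1 + α k) * ‖z k - s‖ ^ 2 - α k * ‖z (k - 1) - s‖ ^ 2
      + inertiaTerm α z k + errTerm lam (totalError ρ f g e₁ e₂ μ) z s k
      - lam k * (κ - lam k) * ‖fbOp ρ f g (μ k) - μ k‖ ^ 2 := by
  have h := relaxed_step_le (e := totalError ρ f g e₁ e₂ μ k) hlam (hquasi (μ k))
  have h2 := norm_inertial_sub_sq (z k) (z (k - 1)) s (α k)
  rw [← hz.inertial k] at h2
  rw [← hz.step_totalError k, h2] at h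
  rw [inertiaTerm, errTerm]
  linarith

lemma lamBar_lt {a σ δ : ℝ} (hκ : 0 < (4 * β - ρ) / (2 * β)) (ha : 0 ≤ a) (hσ : 0 < σ)
    (hδ : 0 < δ) : lamBar β ρ a σ δ < (4 * β - ρ) / (2 * β) := by
  rw [lamBar]
  refine mul_lt_of_lt_one_right hκ ?_
  rw [div_lt_one (by positivity)]
  have h1 : 0 ≤ a * (a * (1 + a) + a * δ + σ) := by positivity
  have h2 : 0 < δ * (a * (1 + a) + a * δ + σ) := by positivity
  linarith

/-- Under the second set of conditions the increments of the iterates are square summable. -/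
lemma ConditionII.summable_sq_norm_sub {a lamLow σ δ : ℝ} {s : H}
    (hc : ConditionII β ρ α lam e₁ e₂ z a lamLow σ δ)
    (hz : IsScheme ρ f g α lam e₁ e₂ z μ) (hκ : 0 < (4 * β - ρ) / (2 * β)) (hρ : 0 < ρ)
    (hprox : ∀ u v, ‖prox ρ g u - prox ρ g v‖ ≤ ‖u - v‖)
    (hquasi : ∀ x, (4 * β - ρ) / (2 * β) * ‖fbOp ρ f g x - x‖ ^ 2
      ≤ 2 * ⟪x - fbOp ρ f g x, x - s⟫_ℝ) :
    Summable fun k : ℕ => ‖z k - z (k - 1)‖ ^ 2 := by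
  set κ := (4 * β - ρ) / (2 * β) with hκdef
  have ha : 0 ≤ a := (hc.inertia_bounds 0).1.trans (hc.inertia_bounds 0).2
  have hlt : lamBar β ρ a σ δ < κ := lamBar_lt hκ ha hc.σ_pos hc.δ_pos
  have hδ := hc.δ_pos
  obtain ⟨C, hC⟩ := exists_norm_le hc.bounded
  have hC' := norm_le_of_bound hC
  have hC0 : 0 ≤ C := (norm_nonneg _).trans (hC 0)
  set e := totalError ρ f g e₁ e₂ μ with he
  have hesum : Summable fun k => ‖e k‖ :=
    Summable.of_nonneg_of_le (fun _ => norm_nonneg _) (norm_totalError_le hprox hρ)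
      ((hc.summable_e₁.mul_left ρ).add hc.summable_e₂)
  have hμ : ∀ k, ‖μ k‖ ≤ 3 * C := by
    intro k
    rw [hz.inertial k]
    have h1 : ‖z k - z (k - 1)‖ ≤ C + C := (norm_sub_le _ _).trans (add_le_add (hC' k) (hC k))
    have h2 : α k ≤ 1 := (hc.inertia_bounds k).2.trans hc.a_lt_one.le
    calc _ ≤ ‖z k‖ + ‖α k • (z k - z (k - 1))‖ := norm_add_le _ _
      _ = ‖z k‖ + α k * ‖z k - z (k - 1)‖ := by
        rw [norm_smul, Real.norm_of_nonneg (hc.inertia_bounds k).1]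
      _ ≤ C + 1 * (C + C) := by
        refine add_le_add (hC' k) (mul_le_mul h2 h1 (norm_nonneg _) zero_le_one)
      _ = 3 * C := by ring
  have hzsucc : ∀ k : ℕ, ‖z (k + 1)‖ ≤ C := fun k => by simpa using hC' (k + 1)
  -- The coefficient of ‖e n‖ collects two errors: 2‖z (n + 1) - s‖ lam n from the recursion, and
  -- 2(κ - lam n)‖z (n + 1) - μ n‖ from replacing the residual by z (n + 1) - μ n.
  refine summable_of_lyapunov (φ := fun n : ℕ => ‖z ((n : ℤ) - 1) - s‖ ^ 2) (α := α)
    (ε := fun n => (2 * (C + ‖s‖) * κ + 2 * κ * (C + 3 * C)) * ‖e n‖)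
    (a := a) (G := a * (1 + a) + a * δ) (σ := σ) (C := (C + ‖s‖) ^ 2) hc.inertia_bounds
    hc.inertia_mono (by positivity) hc.σ_pos (fun _ => by positivity) ?_ (fun _ => by positivity)
    (fun _ => by positivity) (hesum.mul_left _) ?_
  · intro n
    have : ‖z ((n : ℤ) - 1) - s‖ ≤ C + ‖s‖ := (norm_sub_le _ _).trans (by gcongr; exact hC n)
    gcongr
  · intro n
    have hl0 : 0 < lam n := hc.lamLow_pos.trans_le (hc.relax_bounds n).1
    have hlκ : lam n < κ := (hc.relax_bounds n).2.trans_lt hlt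
    have h1 := hz.sq_dist_le hquasi hl0.le
    simp only [Nat.cast_succ, add_sub_cancel_right]
    rw [inertiaTerm, errTerm, ← he] at h1
    set v := z (n + 1) - μ n with hv
    set r := fbOp ρ f g (μ n) - μ n with hr
    have hvr : v - lam n • e n = lam n • r := by
      rw [hv, hz.step_totalError n, ← he, hr]; module
    have h2 : ‖v‖ ^ 2 - 2 * lam n * (‖e n‖ * ‖v‖) ≤ lam n ^ 2 * ‖r‖ ^ 2 := by
      have h3 : lam n ^ 2 * ‖r‖ ^ 2 = ‖v - lam n • e n‖ ^ 2 := by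
        rw [hvr, norm_smul, mul_pow, Real.norm_eq_abs, sq_abs]
      have h4 : 0 ≤ lam n ^ 2 * ‖e n‖ ^ 2 := by positivity
      linarith [norm_sub_smul_sq_ge v (e n) hl0.le]
    -- The decrease in the residual becomes, up to the error, a decrease in v = A - α n • B, where A
    -- and B are consecutive increments of the iterates.
    have h3 : (κ - lam n) / lam n * ‖v‖ ^ 2 - 2 * (κ - lam n) * (‖e n‖ * ‖v‖)
        ≤ lam n * (κ - lam n) * ‖r‖ ^ 2 := by
      have h4 := mul_le_mul_of_nonneg_left h2 (div_nonneg (sub_nonneg.2 hlκ.le) hl0.le)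
      have e1 : (κ - lam n) / lam n * (‖v‖ ^ 2 - 2 * lam n * (‖e n‖ * ‖v‖))
        = (κ - lam n) / lam n * ‖v‖ ^ 2 - 2 * (κ - lam n) * (‖e n‖ * ‖v‖) := by field_simp
      have e2 : (κ - lam n) / lam n * (lam n ^ 2 * ‖r‖ ^ 2)
        = lam n * (κ - lam n) * ‖r‖ ^ 2 := by field_simp
      linarith
    have hvn : ‖v‖ ≤ C + 3 * C := (norm_sub_le _ _).trans (add_le_add (hzsucc n) (hμ n))
    have h4 : 2 * (κ - lam n) * (‖e n‖ * ‖v‖) ≤ 2 * κ * (C + 3 * C) * ‖e n‖ := by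
      have h5 : 2 * (κ - lam n) ≤ 2 * κ := by linarith
      calc 2 * (κ - lam n) * (‖e n‖ * ‖v‖) ≤ 2 * κ * (‖e n‖ * (C + 3 * C)) := by gcongr
        _ = _ := by ring
    have h5 : 2 * ‖z (n + 1) - s‖ * lam n * ‖e n‖ ≤ 2 * (C + ‖s‖) * κ * ‖e n‖ := by
      have : ‖z (n + 1) - s‖ ≤ C + ‖s‖ := (norm_sub_le _ _).trans (by gcongr; exact hzsucc n)
      gcongr
    set A := z (n + 1) - z n with hA
    set B := z n - z (n - 1) with hB
    have hvAB : v = A - α n • B := by rw [hv, hz.inertial n, hA, hB]; module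
    have h6 : ‖A‖ ^ 2 - 2 * α n * (‖A‖ * ‖B‖) + α n ^ 2 * ‖B‖ ^ 2 ≤ ‖v‖ ^ 2 := by
      rw [hvAB]
      exact norm_sub_smul_sq_ge A B (hc.inertia_bounds n).1
    have hl' : lam n / κ ≤ (δ - a * (a * (1 + a) + a * δ + σ)) /
        (δ * (1 + a * (1 + a) + a * δ + σ)) := by
      rw [div_le_iff₀ hκ, mul_comm]
      exact (hc.relax_bounds n).2
    have h7 := relaxation_quadratic_bound (A := ‖A‖) (B := ‖B‖) (hc.inertia_bounds n).1
      (hc.inertia_bounds n).2 hδ hc.σ_pos (div_pos hl0 hκ) hl'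
    have e3 : (1 - lam n / κ) / (lam n / κ) = (κ - lam n) / lam n := by field_simp
    rw [e3] at h7
    have h8 := mul_le_mul_of_nonneg_left h6 (div_nonneg (sub_nonneg.2 hlκ.le) hl0.le)
    linarith

/-- The substantial point is summability of the inertial terms, dominated by the squared increments
because α k ≤ 1. Bounded relaxation parameters take care of the error series. -/
lemma ConditionII.toConditionI {a lamLow σ δ : ℝ} {s : H}
    (hc : ConditionII β ρ α lam e₁ e₂ z a lamLow σ δ)
    (hz : IsScheme ρ f g α lam e₁ e₂ z μ) (hκ : 0 < (4 * β - ρ) / (2 * β)) (hρ : 0 < ρ)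
    (hprox : ∀ u v, ‖prox ρ g u - prox ρ g v‖ ≤ ‖u - v‖)
    (hquasi : ∀ x, (4 * β - ρ) / (2 * β) * ‖fbOp ρ f g x - x‖ ^ 2
      ≤ 2 * ⟪x - fbOp ρ f g x, x - s⟫_ℝ) :
    ConditionI β ρ α lam e₁ e₂ z a lamLow (lamBar β ρ a σ δ) := by
  have ha : 0 ≤ a := (hc.inertia_bounds 0).1.trans (hc.inertia_bounds 0).2
  have hl0 : ∀ k, 0 ≤ lam k := fun k => hc.lamLow_pos.le.trans (hc.relax_bounds k).1
  refine ⟨hc.inertia_bounds, hc.a_lt_one, hc.lamLow_pos, hc.relax_bounds,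
    lamBar_lt hκ ha hc.σ_pos hc.δ_pos, ?_, ?_, ?_, hc.bounded⟩
  · refine Summable.of_nonneg_of_le
      (fun k => mul_nonneg (hc.inertia_bounds k).1 (sq_nonneg _)) (fun k => ?_)
      (hc.summable_sq_norm_sub hz hκ hρ hprox hquasi)
    exact mul_le_of_le_one_left (sq_nonneg _) ((hc.inertia_bounds k).2.trans hc.a_lt_one.le)
  · exact Summable.of_nonneg_of_le (fun k => mul_nonneg (hl0 k) (norm_nonneg _))
      (fun k => mul_le_mul_of_nonneg_right (hc.relax_bounds k).2 (norm_nonneg _))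
      (hc.summable_e₁.mul_left _)
  · exact Summable.of_nonneg_of_le (fun k => mul_nonneg (hl0 k) (norm_nonneg _))
      (fun k => mul_le_mul_of_nonneg_right (hc.relax_bounds k).2 (norm_nonneg _))
      (hc.summable_e₂.mul_left _)

lemma ConditionI.summable_errTerm {a lamLow lamUp : ℝ}
    (hc : ConditionI β ρ α lam e₁ e₂ z a lamLow lamUp) (hρ : 0 < ρ)
    (hprox : ∀ u v, ‖prox ρ g u - prox ρ g v‖ ≤ ‖u - v‖) (s : H) :
    Summable (errTerm lam (totalError ρ f g e₁ e₂ μ) z s) := by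
  obtain ⟨C, hC⟩ := exists_norm_le hc.bounded
  have hl0 : ∀ k, 0 ≤ lam k := fun k => hc.lamLow_pos.le.trans (hc.relax_bounds k).1
  have hsum := ((hc.summable_e₁.mul_left ρ).add hc.summable_e₂).mul_left (2 * (C + ‖s‖))
  refine Summable.of_nonneg_of_le (fun k => ?_) (fun k => ?_) hsum
  · have := hl0 k
    rw [errTerm]
    positivity
  · have h1 : ‖z (k + 1) - s‖ ≤ C + ‖s‖ :=
      (norm_sub_le _ _).trans (by gcongr; simpa using norm_le_of_bound hC (k + 1))
    have h2 := mul_le_mul_of_nonneg_left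
      (norm_totalError_le (f := f) (e₁ := e₁) (e₂ := e₂) (μ := μ) hprox hρ k) (hl0 k)
    have h3 : 0 ≤ C + ‖s‖ := (norm_nonneg _).trans h1
    rw [errTerm]
    calc _ = 2 * ‖z (k + 1) - s‖ * (lam k * ‖totalError ρ f g e₁ e₂ μ k‖) := by ring
      _ ≤ 2 * (C + ‖s‖) * (lam k * (ρ * ‖e₁ k‖ + ‖e₂ k‖)) := by
        refine mul_le_mul (by linarith) h2 (mul_nonneg (hl0 k) (norm_nonneg _)) (by linarith)
      _ = _ := by ring

/-- Behaviour of the scheme relative to one point `s` at which the operator is averaged: convergence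
of the distances, summability of the error series, and the estimate of the residuals. -/
lemma ConditionI.distance_estimates {a lamLow lamUp : ℝ} {s : H}
    (hc : ConditionI β ρ α lam e₁ e₂ z a lamLow lamUp)
    (hz : IsScheme ρ f g α lam e₁ e₂ z μ) (hρ : 0 < ρ)
    (hprox : ∀ u v, ‖prox ρ g u - prox ρ g v‖ ≤ ‖u - v‖)
    (hquasi : ∀ x, (4 * β - ρ) / (2 * β) * ‖fbOp ρ f g x - x‖ ^ 2
      ≤ 2 * ⟪x - fbOp ρ f g x, x - s⟫_ℝ) :
    (∃ l : ℝ, Tendsto (fun k : ℕ => ‖z k - s‖) atTop (𝓝 l)) ∧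
    Summable (incrTerm z s) ∧
    ∀ k : ℕ, ∑ i ∈ Finset.range k, lamLow * ((4 * β - ρ) / (2 * β) - lamUp) *
        ‖fbOp ρ f g (μ (i + 1)) - μ (i + 1)‖ ^ 2
      ≤ ‖z 1 - s‖ ^ 2 + Delta a α lam (totalError ρ f g e₁ e₂ μ) z s := by
  set κ := (4 * β - ρ) / (2 * β) with hκ
  set e := totalError ρ f g e₁ e₂ μ with he
  -- The shift by one makes φ 0 belong to z (-1), so scheme step n governs φ (n + 2), and the sum of
  -- residuals from index 1 starts at φ 2 = ‖z 1 - s‖².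
  set φ : ℕ → ℝ := fun n => ‖z ((n : ℤ) - 1) - s‖ ^ 2 with hφ
  have cast1 : ∀ n : ℕ, ((n + 1 : ℕ) : ℤ) - 1 = n := fun n => by push_cast; ring
  have hφ0 : ∀ n, 0 ≤ φ n := fun n => sq_nonneg _
  have hl0 : ∀ k, 0 ≤ lam k := fun k => hc.lamLow_pos.le.trans (hc.relax_bounds k).1
  set c : ℕ → ℝ := fun n => lamLow * (κ - lamUp) * ‖fbOp ρ f g (μ n) - μ n‖ ^ 2 with hcdef
  have hgap : 0 < κ - lamUp := sub_pos.2 hc.lamUp_lt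
  have hc0 : ∀ n, 0 ≤ c n := fun n =>
    mul_nonneg (mul_nonneg hc.lamLow_pos.le hgap.le) (sq_nonneg _)
  have hrec : ∀ n, φ (n + 2) ≤ (1 + α n) * φ (n + 1) - α n * φ n + inertiaTerm α z n
      + errTerm lam e z s n - c n := by
    intro n
    have h1 := hz.sq_dist_le hquasi (hl0 n)
    have h2 : lamLow * (κ - lamUp) ≤ lam n * (κ - lam n) :=
      mul_le_mul (hc.relax_bounds n).1 (by linarith [(hc.relax_bounds n).2]) hgap.le (hl0 n)
    have h3 := mul_le_mul_of_nonneg_right h2 (sq_nonneg ‖fbOp ρ f g (μ n) - μ n‖)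
    simp only [hφ, hcdef, Nat.cast_succ, add_sub_cancel_right]
    linarith
  have hι0 : ∀ n, 0 ≤ inertiaTerm α z n := fun n => by
    have := (hc.inertia_bounds n).1
    rw [inertiaTerm]
    positivity
  have hε0 : ∀ n, 0 ≤ errTerm lam e z s n := fun n => by
    have := hl0 n
    rw [errTerm]
    positivity
  have hιs := hc.summable_inertiaTerm
  have hεs : Summable (errTerm lam e z s) := hc.summable_errTerm hρ hprox s
  have hp := summable_increments hc.inertia_bounds hc.a_lt_one hι0 hε0 hc0 hιs hεs hrec
  have hincr : ∀ n, incrTerm z s n = max (φ (n + 1) - φ n) 0 := fun n => by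
    simp only [incrTerm, hφ, cast1]
  refine ⟨?_, hp.congr fun n => (hincr n).symm, fun k => ?_⟩
  · obtain ⟨l, hl⟩ := exists_tendsto_of_summable_posPart hφ0 hp
    refine ⟨√l, (((Real.continuous_sqrt.tendsto l).comp hl).comp (tendsto_add_atTop_nat 1)).congr ?_⟩
    intro n
    simp only [Function.comp, hφ, cast1, Real.sqrt_sq (norm_nonneg _)]
  · have h := sum_decrease_le hc.inertia_bounds hφ0 hι0 hε0 hp hιs hεs hrec k
    have e2 : φ 2 = ‖z 1 - s‖ ^ 2 := by simp [hφ]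
    rw [e2] at h
    simp only [Delta, hincr]
    exact h

/-- Weak convergence of the iterates to a point of a set that contains the fixed points. -/
lemma ConditionI.weakLim {a lamLow lamUp : ℝ} {S : Set H} (hS : S.Nonempty)
    (hc : ConditionI β ρ α lam e₁ e₂ z a lamLow lamUp)
    (hz : IsScheme ρ f g α lam e₁ e₂ z μ) (hρ : 0 < ρ)
    (hprox : ∀ u v, ‖prox ρ g u - prox ρ g v‖ ≤ ‖u - v‖)
    (hT : ∀ x y, ‖fbOp ρ f g x - fbOp ρ f g y‖ ≤ ‖x - y‖)
    (hfix : ∀ p, fbOp ρ f g p = p → p ∈ S)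
    (hquasi : ∀ s ∈ S, ∀ x, (4 * β - ρ) / (2 * β) * ‖fbOp ρ f g x - x‖ ^ 2
      ≤ 2 * ⟪x - fbOp ρ f g x, x - s⟫_ℝ) :
    ∃ p ∈ S, WeakLim (fun k : ℕ => z k) atTop p := by
  obtain ⟨s, hs⟩ := hS
  obtain ⟨C, hC⟩ := exists_norm_le hc.bounded
  have hC' := norm_le_of_bound hC
  have hgap : 0 < (4 * β - ρ) / (2 * β) - lamUp := sub_pos.2 hc.lamUp_lt
  have hres : Tendsto (fun k => ‖fbOp ρ f g (μ k) - μ k‖) atTop (𝓝 0) := by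
    have hbound := (hc.distance_estimates hz hρ hprox (hquasi s hs)).2.2
    have hpos : 0 < lamLow * ((4 * β - ρ) / (2 * β) - lamUp) := mul_pos hc.lamLow_pos hgap
    have hsum := summable_of_sum_range_le
      (fun n => mul_nonneg hpos.le (sq_nonneg ‖fbOp ρ f g (μ (n + 1)) - μ (n + 1)‖)) hbound
    rw [summable_mul_left_iff hpos.ne'] at hsum
    have h1 := (Real.continuous_sqrt.tendsto 0).comp hsum.tendsto_atTop_zero
    rw [Real.sqrt_zero] at h1
    refine (tendsto_add_atTop_iff_nat 1).1 (h1.congr fun k => ?_)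
    simp [Function.comp, Real.sqrt_sq (norm_nonneg _)]
  have hdiff : Tendsto (fun k : ℕ => ‖μ k - z k‖) atTop (𝓝 0) := by
    have h1 := (Real.continuous_sqrt.tendsto 0).comp hc.summable_inertia.tendsto_atTop_zero
    rw [Real.sqrt_zero] at h1
    -- Since 0 ≤ α k ≤ 1, ‖μ k - z k‖² = (α k)²‖z k - z (k - 1)‖² is at most the k-th summand of the
    -- convergent inertia series.
    refine squeeze_zero (fun _ => norm_nonneg _) (fun k => Real.le_sqrt_of_sq_le ?_) h1
    have h0 := (hc.inertia_bounds k).1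
    have h2 : α k ≤ 1 := (hc.inertia_bounds k).2.trans hc.a_lt_one.le
    rw [hz.inertial k, add_sub_cancel_left, norm_smul, mul_pow, Real.norm_eq_abs, sq_abs]
    gcongr
    nlinarith
  have hμ : ∀ k, ‖μ k‖ ≤ C + (C + C) := by
    intro k
    have h0 := (hc.inertia_bounds k).1
    have h2 : α k ≤ 1 := (hc.inertia_bounds k).2.trans hc.a_lt_one.le
    have h1 : ‖z k - z (k - 1)‖ ≤ C + C := (norm_sub_le _ _).trans (add_le_add (hC' k) (hC k))
    rw [hz.inertial k]
    refine (norm_add_le _ _).trans (add_le_add (hC' k) ?_)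
    rw [norm_smul, Real.norm_of_nonneg h0]
    exact (mul_le_of_le_one_left (norm_nonneg _) h2).trans h1
  refine exists_weakLim_of_tendsto_dist hC'
    (fun p hp => (hc.distance_estimates hz hρ hprox (hquasi p hp)).1) fun U p hU hp => hfix p ?_
  -- Residuals are controlled at μ k, not at z k, so the weak limit is first transferred from z to
  -- μ.
  exact (hp.add_tendsto_zero (hdiff.mono_left hU)).fixedPoint hT hμ (hres.mono_left hU)

end Scheme

end InertialFB

theorem corollary4p2 {H : Type*} [NormedAddCommGroup H] [InnerProductSpace ℝ H] [CompleteSpace H]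
    (β ρ : ℝ) (hβ : 0 < β) (hρ : 0 < ρ) (hρβ : ρ < 2 * β)
    (f : H → ℝ) (hf_convex : ConvexOn ℝ Set.univ f) (hf_diff : Differentiable ℝ f)
    (hf_lip : ∀ x y, ‖∇ f x - ∇ f y‖ ≤ 1 / β * ‖x - y‖)
    (g : H → EReal) (hg_proper : InertialFB.IsProper g) (hg_convex : InertialFB.IsConvex g)
    (hg_lsc : LowerSemicontinuous g)
    (hΩ : (InertialFB.argmin (InertialFB.objective f g)).Nonempty)
    (α lam : ℕ → ℝ) (e₁ e₂ : ℕ → H) (z : ℤ → H) (μ : ℕ → H)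
    (hz : InertialFB.IsScheme ρ f g α lam e₁ e₂ z μ)
    (a lamLow θ : ℝ)
    (hcond : InertialFB.ConditionI β ρ α lam e₁ e₂ z a lamLow θ ∨
      ∃ σ δ : ℝ, InertialFB.ConditionII β ρ α lam e₁ e₂ z a lamLow σ δ ∧
        θ = InertialFB.lamBar β ρ a σ δ) :
    (∀ zs ∈ InertialFB.argmin (InertialFB.objective f g),
      ∃ l : ℝ, Tendsto (fun k : ℕ => ‖z k - zs‖) atTop (𝓝 l)) ∧
    (∃ zbar ∈ InertialFB.argmin (InertialFB.objective f g),
      Tendsto (fun k : ℕ => toWeakSpace ℝ H (z k)) atTop (𝓝 (toWeakSpace ℝ H zbar))) ∧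
    0 < (4 * β - ρ) / (2 * β) - θ ∧
    ∀ zs ∈ InertialFB.argmin (InertialFB.objective f g),
      Summable (fun k : ℕ => InertialFB.incrTerm z zs (k + 1)) ∧
      Summable (fun k : ℕ => InertialFB.errTerm lam
        (InertialFB.totalError ρ f g e₁ e₂ μ) z zs (k + 1)) ∧
      Summable (fun k : ℕ => InertialFB.inertiaTerm α z (k + 1)) ∧
      ∀ (k : ℕ) (hk : 1 ≤ k),
        (Finset.Icc 1 k).inf' (Finset.nonempty_Icc.mpr hk)
            (fun i => ‖InertialFB.fbOp ρ f g (μ i) - μ i‖ ^ 2)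
          ≤ 1 / (k * lamLow * ((4 * β - ρ) / (2 * β) - θ)) *
            (‖z 1 - zs‖ ^ 2 +
              InertialFB.Delta a α lam (InertialFB.totalError ρ f g e₁ e₂ μ) z zs) := by
  obtain ⟨s₀, hs₀⟩ := hΩ
  -- A minimizer of f + g supplies a subgradient of g, hence the affine minorant needed for proximal
  -- points to exist; no separation argument is required.
  have hsub := InertialFB.isSubgradient_neg_gradient hf_diff hg_proper hg_convex hs₀
  have hprox := InertialFB.prox_nonexpansive hρ hg_proper hg_convex hg_lsc hsub
  have hT := InertialFB.fbOp_nonexpansive hβ hρ hρβ hf_convex hf_diff hf_lip hg_proper hg_convex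
    hg_lsc hsub
  have hquasi : ∀ s ∈ InertialFB.argmin (InertialFB.objective f g), ∀ x, _ := fun s hs =>
    InertialFB.fbOp_quasi_averaged hβ hρ hf_convex hf_diff hf_lip hg_proper hg_convex hg_lsc hs
  have hκ : 0 < (4 * β - ρ) / (2 * β) := div_pos (by linarith) (by linarith)
  have hc : InertialFB.ConditionI β ρ α lam e₁ e₂ z a lamLow θ := by
    rcases hcond with h | ⟨σ, δ, h, rfl⟩
    · exact h
    · exact h.toConditionI hz hκ hρ hprox (hquasi s₀ hs₀)
  have hgap : 0 < (4 * β - ρ) / (2 * β) - θ := sub_pos.2 hc.lamUp_lt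
  refine ⟨fun s hs => (hc.distance_estimates hz hρ hprox (hquasi s hs)).1, ?_, hgap,
    fun s hs => ?_⟩
  · obtain ⟨p, hp, hlim⟩ := hc.weakLim ⟨s₀, hs₀⟩ hz hρ hprox hT
      (fun p hp => InertialFB.mem_argmin_of_fbOp_eq hρ hf_convex hf_diff hg_proper hg_convex
        hg_lsc hsub hp) hquasi
    exact ⟨p, hp, hlim.tendsto_toWeakSpace⟩
  · obtain ⟨-, hincr, hbound⟩ := hc.distance_estimates hz hρ hprox (hquasi s hs)
    refine ⟨(summable_nat_add_iff 1).2 hincr,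
      (summable_nat_add_iff 1).2 (hc.summable_errTerm hρ hprox s),
      (summable_nat_add_iff 1).2 hc.summable_inertiaTerm, fun k hk => ?_⟩
    have hk0 : (0 : ℝ) < k := by exact_mod_cast hk
    have hpos : 0 < k * lamLow * ((4 * β - ρ) / (2 * β) - θ) :=
      mul_pos (mul_pos hk0 hc.lamLow_pos) hgap
    rw [one_div_mul_eq_div, le_div_iff₀ hpos]
    refine le_trans ?_ (hbound k)
    set m := (Finset.Icc 1 k).inf' (Finset.nonempty_Icc.mpr hk)
      (fun i => ‖InertialFB.fbOp ρ f g (μ i) - μ i‖ ^ 2) with hm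
    -- Each of the k summands, reindexed from 1, ..., k to 0, ..., k - 1, dominates the one with the
    -- minimum, which produces the factor 1/k.
    have hle : ∀ i ∈ Finset.range k, lamLow * ((4 * β - ρ) / (2 * β) - θ) * m ≤
        lamLow * ((4 * β - ρ) / (2 * β) - θ) *
          ‖InertialFB.fbOp ρ f g (μ (i + 1)) - μ (i + 1)‖ ^ 2 := by
      intro i hi
      refine mul_le_mul_of_nonneg_left ?_ (mul_pos hc.lamLow_pos hgap).le
      exact Finset.inf'_le (fun i => ‖InertialFB.fbOp ρ f g (μ i) - μ i‖ ^ 2)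
        (Finset.mem_Icc.2 ⟨by omega, by have := Finset.mem_range.1 hi; omega⟩)
    have h := Finset.card_nsmul_le_sum _ _ _ hle
    rw [Finset.card_range, nsmul_eq_mul] at h
    linarith
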